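/- Let $n\ge 1$ and let $K\subset\mathbb R^n$ be a nondegenerate $n$-simplex. Let $\mathbb S$ be the space of symmetric real $n\times n$ matrices, $P_k(K;\mathbb S)$ the space of $\mathbb S$-valued polynomial fields of degree at most $k$, and $\mathrm{div}$ the row-wise divergence. Let $\Sigma_{3\to n+1,DF}(K;\mathbb S)$ be the space of fields $\tau\in P_{n+1}(K;\mathbb S)$ with $\mathrm{div}\,\tau=0$ whose entries contain only monomials of degrees $3,\dots,n+1$, and put $$P_2^*(K;\mathbb S)=P_2(K;\mathbb S)+\Sigma_{3\to n+1,DF}(K;\mathbb S),\qquad M_2(K)=\{\tau\in P_2^*(K;\mathbb S):\ \mathrm{div}\,\tau=0,\ \tau\nu=0\text{ on }\partial K\},$$ where $\nu$ is normal to $\partial K$. Write $C_a^b$ for binomial coefficients. Theorem 3.1. A field $\tau\in P_2^*(K;\mathbb S)$ is uniquely determined by the following degrees of freedom. 1. For each $\ell$-dimensional sub-simplex $\triangle_\ell$ of $K$, $0\le\ell\le n-1$, with any $\ell$ linearly independent tangential vectors $t_1,\dots,t_\ell$ and any $n-\ell$ linearly independent normal vectors $\nu_1,\dots,\nu_{n-\ell}$: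 the mean moments over $\triangle_\ell$ of $t_l^T\tau\nu_i$ and of $\nu_i^T\tau\nu_j$ ($1\le l\le\ell$, $1\le i\le j\le n-\ell$ in the second case) against a basis of $P_{n-\ell}(\triangle_\ell)$, the restrictions to $\triangle_\ell$ of polynomials of degree at most $n-\ell$, which has dimension $C_n^\ell$. (For $\ell=0$ these are point values at a vertex.) These are $\big(C_{n+1-\ell}^2+\ell(n-\ell)\big)C_n^\ell=\frac{(n-\ell)(n+\ell+1)}2C_n^\ell$ degrees of freedom for each $\triangle_\ell$. 2. The average of $\tau$ over $K$: $\frac{n(n+1)}2$ degrees of freedom. 3. The moments $\int_K\tau:\theta\,dx$ with $\theta$ in a basis of $M_2(K)$: $$\dim M_2(K)=\frac{(2n-1)!}{n!(n-1)!}\frac{n(n+1)}2+\frac{n(n+1)}2-n\frac{(2n)!}{n!n!}$$ degrees of freedom. That is, for every choice of the tangential vectors, normal vectors and bases, each prescription of real values for these degrees of freedom is attained by exactly one $\tau\in P_2^*(K;\mathbb S)$. The total number of degrees of freedom in the first set is $$\sum_{\ell=0}^{n-1}C_{n+1}^{\ell+1}\frac{(n-\ell)(n+\ell+1)}2C_n^\ell=\frac{(2n+1)!}{n!(n+1)!}\frac{n(n+1)}2-\frac{(2n-1)!}{n!(n-1)!}\frac{n(n+1)}2,$$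 and the number of degrees of freedom in all three sets equals $$\dim P_2^*(K;\mathbb S)=\frac{(2n+1)!}{n!(n+1)!}\frac{n(n+1)}2-n\frac{(2n)!}{n!n!}+n(n+1).$$ -/

import Mathlib

open MeasureTheory

noncomputable section

namespace SymFE

/-- Euclidean space `ℝⁿ`. -/
abbrev E (n : ℕ) := EuclideanSpace ℝ (Fin n)

/-- Polynomial `n × n` matrix fields on `ℝⁿ`. As an `n`-simplex has nonempty interior, a polynomial
field on it is the same thing as a polynomial field on `ℝⁿ`. -/
abbrev MatField (n : ℕ) := Matrix (Fin n) (Fin n) (MvPolynomial (Fin n) ℝ)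

/-- The value `τ(x)`, a real matrix. -/
def evalAt {n : ℕ} (τ : MatField n) (x : E n) : Matrix (Fin n) (Fin n) ℝ :=
  τ.map (MvPolynomial.eval x.ofLp)

/-- The row-wise divergence, `(div τ)ᵢ = ∑ⱼ ∂ⱼ τᵢⱼ`. -/
def divergence {n : ℕ} (τ : MatField n) : Fin n → MvPolynomial (Fin n) ℝ :=
  fun i => ∑ j, MvPolynomial.pderiv j (τ i j)

/-- `P_k(K; 𝕊)`: symmetric matrix fields with polynomial entries of total degree at most `k`. -/
def symPoly (n k : ℕ) : Submodule ℝ (MatField n) where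
  carrier := {τ | τ.IsSymm ∧ ∀ i j, τ i j ∈ MvPolynomial.restrictTotalDegree (Fin n) ℝ k}
  add_mem' ha hb := ⟨ha.1.add hb.1, fun i j => Submodule.add_mem _ (ha.2 i j) (hb.2 i j)⟩
  zero_mem' := ⟨Matrix.isSymm_zero, fun _ _ => Submodule.zero_mem _⟩
  smul_mem' c _ ha := ⟨ha.1.smul c, fun i j => Submodule.smul_mem _ c (ha.2 i j)⟩

/-- `Σ_{3→n+1,DF}(K; 𝕊)`: divergence-free symmetric matrix fields all of whose entries involve only
monomials of degrees `3, …, n + 1`. -/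
def divFreePart (n : ℕ) : Submodule ℝ (MatField n) where
  carrier := {τ | τ.IsSymm ∧ (∀ i j, τ i j ∈
    MvPolynomial.restrictSupport ℝ {m : Fin n →₀ ℕ | 3 ≤ m.degree ∧ m.degree ≤ n + 1}) ∧ divergence τ = 0}
  add_mem' ha hb := ⟨ha.1.add hb.1, fun i j => Submodule.add_mem _ (ha.2.1 i j) (hb.2.1 i j), by
    funext i
    have h1 := congrFun ha.2.2 i
    have h2 := congrFun hb.2.2 i
    simp only [divergence, Pi.zero_apply] at h1 h2
    simp [divergence, Finset.sum_add_distrib, h1, h2]⟩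
  zero_mem' := ⟨Matrix.isSymm_zero, fun _ _ => Submodule.zero_mem _, by funext i; simp [divergence]⟩
  smul_mem' c _ ha := ⟨ha.1.smul c, fun i j => Submodule.smul_mem _ c (ha.2.1 i j), by
    funext i
    have h1 := congrFun ha.2.2 i
    simp only [divergence, Pi.zero_apply] at h1
    simp [divergence, ← Finset.smul_sum, h1]⟩

/-- The enriched space `P₂*(K; 𝕊) = P₂(K; 𝕊) + Σ_{3→n+1,DF}(K; 𝕊)`. -/
def P2Star (n : ℕ) : Submodule ℝ (MatField n) := symPoly n 2 ⊔ divFreePart n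

/-- The `ℓ`-dimensional sub-simplices of an `n`-simplex, given by their `ℓ + 1` vertices. -/
abbrev Face (n ℓ : ℕ) := {s : Finset (Fin (n + 1)) // s.card = ℓ + 1}

/-- The (closed) sub-simplex `△_ℓ` of `K`, as a set of points. -/
def faceSet {n ℓ : ℕ} (K : Affine.Simplex ℝ (E n) n) (s : Face n ℓ) : Set (E n) :=
  (K.face s.2).closedInterior

/-- The vectors tangential to a sub-simplex. -/
def tangentSpace {n ℓ : ℕ} (K : Affine.Simplex ℝ (E n) n) (s : Face n ℓ) : Submodule ℝ (E n) :=
  vectorSpan ℝ (Set.range (K.face s.2).points)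

/-- The vectors normal to a sub-simplex. -/
def normalSpace {n ℓ : ℕ} (K : Affine.Simplex ℝ (E n) n) (s : Face n ℓ) : Submodule ℝ (E n) :=
  (tangentSpace K s)ᗮ

/-- `M₂(K)`: the fields `τ` in `P₂*(K; 𝕊)` with `div τ = 0` and `τ ν = 0` on `∂K` (the union of the
sub-simplices of dimension `n - 1`). -/
def M2 {n : ℕ} (K : Affine.Simplex ℝ (E n) n) : Submodule ℝ (MatField n) where
  carrier := {τ | τ ∈ P2Star n ∧ divergence τ = 0 ∧
    ∀ s : Face n (n - 1), ∀ x ∈ faceSet K s, ∀ ν ∈ normalSpace K s,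
      (evalAt τ x).mulVec ν.ofLp = 0}
  add_mem' ha hb := ⟨Submodule.add_mem _ ha.1 hb.1, by
    funext i
    have h1 := congrFun ha.2.1 i
    have h2 := congrFun hb.2.1 i
    simp only [divergence, Pi.zero_apply] at h1 h2
    simp [divergence, Finset.sum_add_distrib, h1, h2], fun s x hx ν hν => by
    have h1 := ha.2.2 s x hx ν hν
    have h2 := hb.2.2 s x hx ν hν
    rw [evalAt, Matrix.map_add _ (by simp), Matrix.add_mulVec]
    rw [evalAt] at h1 h2
    rw [h1, h2, add_zero]⟩
  zero_mem' := ⟨Submodule.zero_mem _, by funext i; simp [divergence], fun s x hx ν hν => by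
    simp [evalAt]⟩
  smul_mem' c a ha := ⟨Submodule.smul_mem _ c ha.1, by
    funext i
    have h1 := congrFun ha.2.1 i
    simp only [divergence, Pi.zero_apply] at h1
    simp [divergence, ← Finset.smul_sum, h1], fun s x hx ν hν => by
    have h1 := ha.2.2 s x hx ν hν
    have h2 : evalAt (c • a) x = c • evalAt a x := by
      ext i j
      simp [evalAt]
    rw [h2, Matrix.smul_mulVec, h1, smul_zero]⟩

/-- Restriction of a real polynomial on `ℝⁿ` to a set, as a function on this set. -/
def restrictTo {n : ℕ} (S : Set (E n)) : MvPolynomial (Fin n) ℝ →ₗ[ℝ] (S → ℝ) :=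
  LinearMap.pi fun x => (MvPolynomial.aeval x.1.ofLp).toLinearMap

/-- `P_k(△_ℓ)`: the functions on a sub-simplex which are polynomials of degree at most `k`. -/
def facePoly {n ℓ : ℕ} (K : Affine.Simplex ℝ (E n) n) (s : Face n ℓ) (k : ℕ) :
    Submodule ℝ (faceSet K s → ℝ) :=
  (MvPolynomial.restrictTotalDegree (Fin n) ℝ k).map (restrictTo (faceSet K s))

/-- The mean moment over `△_ℓ`, with weight `q`, of the component `uᵀ τ v`; the mean is taken with
respect to the `ℓ`-dimensional Hausdorff measure. -/
def faceMoment {n ℓ : ℕ} (K : Affine.Simplex ℝ (E n) n) (s : Face n ℓ) (u v : E n)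
    (q : MvPolynomial (Fin n) ℝ) (τ : MatField n) : ℝ :=
  ⨍ x in faceSet K s,
    (u.ofLp ⬝ᵥ (evalAt τ x).mulVec v.ofLp) * MvPolynomial.eval x.ofLp q ∂μHE[ℓ]

/-- The average over `K` of the component `τᵢⱼ`. -/
def meanEntry {n : ℕ} (K : Affine.Simplex ℝ (E n) n) (i j : Fin n) (τ : MatField n) : ℝ :=
  ⨍ x in K.closedInterior, evalAt τ x i j

/-- `∫_K τ : θ dx`. -/
def innerK {n : ℕ} (K : Affine.Simplex ℝ (E n) n) (θ τ : MatField n) : ℝ :=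
  ∫ x in K.closedInterior, ∑ i, ∑ j, evalAt τ x i j * evalAt θ x i j

/-- Index pairs `i ≤ j`: the independent components of a symmetric `m × m` matrix. -/
abbrev SymPair (m : ℕ) := {p : Fin m × Fin m // p.1 ≤ p.2}

/-- Labels of the degrees of freedom on one `ℓ`-dimensional sub-simplex: a tangential-normal
component `t_lᵀ τ ν_i` or a normal-normal component `ν_iᵀ τ ν_j` (`i ≤ j`, as `τ` is symmetric),
and an element of a basis of the weights `P_{n-ℓ}(△_ℓ)`. -/
abbrev FaceIndex (n ℓ : ℕ) := (Fin ℓ × Fin (n - ℓ) ⊕ SymPair (n - ℓ)) × Fin (n.choose ℓ)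

/-- Labels of the first set of degrees of freedom, over all sub-simplices of dimensions
`0, …, n - 1`. -/
abbrev BoundaryIndex (n : ℕ) := Σ ℓ : Fin n, Face n ℓ × FaceIndex n ℓ

/-- Labels of all degrees of freedom; `m` is the number of moments against `M₂(K)`. -/
abbrev DofIndex (n m : ℕ) := BoundaryIndex n ⊕ SymPair n ⊕ Fin m

/-- The values at `τ` of all degrees of freedom, for given tangential vectors `t`, normal vectors
`ν` and weights `q` on the sub-simplices, and given fields `θ`. -/
def dofs {n m : ℕ} (K : Affine.Simplex ℝ (E n) n)
    (t : (ℓ : Fin n) → Face n ℓ → Fin ℓ → E n)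
    (ν : (ℓ : Fin n) → Face n ℓ → Fin (n - ℓ) → E n)
    (q : (ℓ : Fin n) → Face n ℓ → Fin (n.choose ℓ) → MvPolynomial (Fin n) ℝ)
    (θ : Fin m → MatField n) (τ : MatField n) : DofIndex n m → ℝ
  | .inl ⟨ℓ, s, .inl (l, i), a⟩ => faceMoment K s (t ℓ s l) (ν ℓ s i) (q ℓ s a) τ
  | .inl ⟨ℓ, s, .inr p, a⟩ => faceMoment K s (ν ℓ s p.1.1) (ν ℓ s p.1.2) (q ℓ s a) τ
  | .inr (.inl p) => meanEntry K p.1.1 p.1.2 τ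
  | .inr (.inr b) => innerK K (θ b) τ

end SymFE

end

open SymFE
open scoped Nat

/-!
Everything is computed in the barycentric coordinates `λ₀, …, λₙ` of the simplex `K` with vertices
`x₀, …, xₙ`. A polynomial of degree at most `k` is a form of degree `k` in the `λᵢ`
(`exists_subst_eq`), and it vanishes on a sub-simplex if and only if the coefficients of the
monomials in the variables of that sub-simplex vanish (`coeff_eq_zero_of_faceSet`). Hence
divisibility by products of barycentric coordinates can be read off from the monomials.

*Fields with `τ ν = 0` on the boundary.* The matrices `t tᵀ`, for the edge vectors `t = xᵢ - xⱼ`,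
span the symmetric matrices, and the coefficient of `t tᵀ` in `τ` is `-∇λᵢᵀ τ ∇λⱼ`. It vanishes on
the facets `λᵢ = 0` and `λⱼ = 0` when `τ ν = 0` on the boundary, so that `τ = ∑ λᵢ λⱼ pᵢⱼ t tᵀ`
(`exists_eq_bubble`). As the integral over `K` of `∂ₜ(λᵢ λⱼ p)` is zero
(`polyIntegral_dirDeriv_edge`), such fields can be integrated by parts without boundary terms: `∫
div τ · v = -∑ ∫ λᵢ λⱼ pᵢⱼ ∂ₜ(t · v)` (`polyIntegral_divergence_bubble`).

*Dimensions.* Taking `pᵢⱼ = ∂ₜ(t · v)`, one sees that a vector field `v` of degree at most `n`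
which is orthogonal to the divergences of these fields has zero symmetric gradient
(`orthogonal_divergence_iff`), that is, it is a rigid motion; the rank theorem then gives the
dimension of `M₂(K)` (`finrank_M2`). The enriched space is the space of the symmetric fields of
degree at most `n + 1` with divergence of degree at most one (`mem_P2Star_iff`), and the
divergence is onto, which gives the dimension of `P₂*(K; 𝕊)` (`finrank_P2Star`). A Vandermonde
identity shows that it is the number of degrees of freedom (`sum_boundary`).

*Unisolvence.* It remains to show that `τ` is zero if its degrees of freedom vanish. By induction
on the dimension of a sub-simplex `△` of dimension `ℓ < n`, `τ ν = 0` on `△` for the normal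
vectors `ν` of `△`: a component `uᵀ τ ν` vanishes on the boundary of `△`, so on `△` it is the
product of `ℓ + 1` barycentric coordinates and of some `g` of degree at most `n - ℓ`, and its
moment against `g`, the integral of this product times `g`, is zero, so that `g = 0`
(`component_eq_zero_on_face`). Next, `div τ` is affine, and integrating by parts against an affine
field involves `τ` only through its mean, so that `div τ` is orthogonal to itself
(`divergence_eq_zero`). Thus `τ ∈ M₂(K)`, and `τ` is orthogonal to `M₂(K)`.
-/

open MeasureTheory

noncomputable section

namespace SymFE

/-! ### Barycentric coordinates as polynomials -/

section Barycentric

variable {n : ℕ} (K : Affine.Simplex ℝ (E n) n)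

/-- The affine basis of `ℝⁿ` formed by the vertices of an `n`-simplex. -/
def vertexBasis : AffineBasis (Fin (n + 1)) ℝ (E n) where
  toFun := K.points
  ind' := K.independent
  tot' := K.independent.affineSpan_eq_top_iff_card_eq_finrank_add_one.2 (by simp)

@[simp] lemma vertexBasis_apply (i : Fin (n + 1)) : vertexBasis K i = K.points i := rfl

/-- The `k`-th component of the gradient of the barycentric coordinate `λᵢ`. -/
def baryGrad (i : Fin (n + 1)) (k : Fin n) : ℝ :=
  ((vertexBasis K).coord i).linear (EuclideanSpace.single k 1)

/-- The barycentric coordinate `λᵢ`, as a polynomial of degree at most one. -/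
def bary (i : Fin (n + 1)) : MvPolynomial (Fin n) ℝ :=
  MvPolynomial.C ((vertexBasis K).coord i 0) +
    ∑ k, MvPolynomial.C (baryGrad K i k) * MvPolynomial.X k

lemma coord_linear_apply (i : Fin (n + 1)) (v : E n) :
    ((vertexBasis K).coord i).linear v = ∑ k, baryGrad K i k * v k := by
  conv_lhs => rw [← (EuclideanSpace.basisFun (Fin n) ℝ).sum_repr v]
  simp [baryGrad, mul_comm]

@[simp] lemma eval_bary (i : Fin (n + 1)) (x : E n) :
    MvPolynomial.eval x.ofLp (bary K i) = (vertexBasis K).coord i x := by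
  have h := ((vertexBasis K).coord i).decomp
  have h2 := congrFun h x
  rw [h2, Pi.add_apply, coord_linear_apply, add_comm]
  simp [bary]

@[simp] lemma pderiv_bary (i : Fin (n + 1)) (k : Fin n) :
    MvPolynomial.pderiv k (bary K i) = MvPolynomial.C (baryGrad K i k) := by
  simp [bary, MvPolynomial.pderiv_X, Pi.single_apply]

lemma sum_bary : ∑ i, bary K i = 1 := by
  refine MvPolynomial.funext fun x => ?_
  have := (vertexBasis K).sum_coord_apply_eq_one (WithLp.toLp 2 x)
  simpa [← eval_bary] using this

lemma sum_bary_mul_vertex (k : Fin n) :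
    ∑ i, bary K i * MvPolynomial.C (K.points i k) = MvPolynomial.X k := by
  refine MvPolynomial.funext fun x => ?_
  have := (vertexBasis K).linear_combination_coord_eq_self (WithLp.toLp 2 x)
  have h2 := congrArg (fun v : E n => v k) this
  simpa [← eval_bary] using h2

lemma bary_mem (i : Fin (n + 1)) :
    bary K i ∈ MvPolynomial.restrictTotalDegree (Fin n) ℝ 1 := by
  refine Submodule.add_mem _ ?_ (Submodule.sum_mem _ fun k _ => ?_)
  · rw [MvPolynomial.mem_restrictTotalDegree]
    simp
  · rw [MvPolynomial.mem_restrictTotalDegree]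
    refine (MvPolynomial.totalDegree_mul _ _).trans ?_
    simp

/-- The components of the edge vector `xᵢ - xⱼ`. -/
def edge (i j : Fin (n + 1)) (k : Fin n) : ℝ := K.points i k - K.points j k

lemma sum_baryGrad_mul_edge (a i j : Fin (n + 1)) :
    ∑ k, baryGrad K a k * edge K i j k = (if a = i then 1 else 0) - if a = j then 1 else 0 := by
  have h := coord_linear_apply K a (K.points i - K.points j)
  have h2 := ((vertexBasis K).coord a).linearMap_vsub (K.points i) (K.points j)
  simp only [vsub_eq_sub] at h2
  rw [h2, ← vertexBasis_apply, ← vertexBasis_apply, AffineBasis.coord_apply,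
    AffineBasis.coord_apply] at h
  simpa [edge] using h.symm

lemma bary_ne_zero (i : Fin (n + 1)) : bary K i ≠ 0 := by
  intro h
  have := eval_bary K i (K.points i)
  rw [h, ← vertexBasis_apply, AffineBasis.coord_apply] at this
  simp at this

lemma sum_coord_smul (x : E n) : ∑ i, (vertexBasis K).coord i x • K.points i = x :=
  (vertexBasis K).linear_combination_coord_eq_self x

lemma coord_sum_smul {w : Fin (n + 1) → ℝ} (hw : ∑ i, w i = 1) (i : Fin (n + 1)) :
    (vertexBasis K).coord i (∑ j, w j • K.points j) = w i := by
  have h := (vertexBasis K).coord_apply_combination_of_mem (Finset.mem_univ i) hw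
  rwa [Finset.affineCombination_eq_linear_combination _ _ _ hw] at h

lemma mem_faceSet_iff {ℓ : ℕ} (s : Face n ℓ) (x : E n) :
    x ∈ faceSet K s ↔ (∀ i, 0 ≤ (vertexBasis K).coord i x) ∧
      ∀ i ∉ s.1, (vertexBasis K).coord i x = 0 := by
  have h1 := (vertexBasis K).sum_coord_apply_eq_one x
  have h := K.affineCombination_mem_closedInterior_face_iff_nonneg s.2 h1
  rw [Finset.affineCombination_eq_linear_combination _ _ _ h1, sum_coord_smul] at h
  rw [faceSet, h]
  refine and_congr_left fun h0 => ⟨fun h i => ?_, fun h i _ => h i⟩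
  by_cases hi : i ∈ s.1
  · exact h i hi
  · exact (h0 i hi).ge

lemma mem_closedInterior_iff (x : E n) :
    x ∈ K.closedInterior ↔ ∀ i, 0 ≤ (vertexBasis K).coord i x := by
  have h1 := (vertexBasis K).sum_coord_apply_eq_one x
  have h := Affine.Simplex.affineCombination_mem_closedInterior_iff (s := K) h1
  rw [Finset.affineCombination_eq_linear_combination _ _ _ h1, sum_coord_smul] at h
  rw [h]
  refine ⟨fun h i => (h i).1, fun h i => ⟨h i, ?_⟩⟩
  rw [← h1]
  exact Finset.single_le_sum (fun j _ => h j) (Finset.mem_univ i)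

end Barycentric

/-! ### Homogeneous polynomials in the barycentric coordinates -/

section Bernstein

variable {n : ℕ} (K : Affine.Simplex ℝ (E n) n)

/-- Substitution of the barycentric coordinates `λ₀, …, λₙ` for the variables. -/
def subst : MvPolynomial (Fin (n + 1)) ℝ →ₐ[ℝ] MvPolynomial (Fin n) ℝ :=
  MvPolynomial.aeval (bary K)

@[simp] lemma subst_X (i : Fin (n + 1)) : subst K (MvPolynomial.X i) = bary K i := by
  simp [subst]

lemma eval_subst (F : MvPolynomial (Fin (n + 1)) ℝ) (x : E n) :
    MvPolynomial.eval x.ofLp (subst K F) =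
      MvPolynomial.eval (fun i => (vertexBasis K).coord i x) F := by
  rw [subst, MvPolynomial.aeval_def, MvPolynomial.eval_eval₂]
  simp only [eval_bary]
  congr 1
  ext
  simp

/-- Homogeneous polynomials of degree `k` in the variables with index in `s`: the barycentric
representatives of the polynomials of degree at most `k` on the face with vertices in `s`. -/
def homog (s : Finset (Fin (n + 1))) (k : ℕ) : Submodule ℝ (MvPolynomial (Fin (n + 1)) ℝ) :=
  MvPolynomial.restrictSupport ℝ {m | m.degree = k ∧ m.support ⊆ s}

lemma mem_homog_iff {s : Finset (Fin (n + 1))} {k : ℕ} {F : MvPolynomial (Fin (n + 1)) ℝ} :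
    F ∈ homog s k ↔ ∀ m ∈ F.support, m.degree = k ∧ m.support ⊆ s := by
  rw [homog, MvPolynomial.mem_restrictSupport_iff]
  rfl

lemma weight_one_eq_degree (m : Fin (n + 1) →₀ ℕ) : Finsupp.weight 1 m = m.degree :=
  (DFunLike.congr_fun (Finsupp.degree_eq_weight_one (R := ℕ)) m).symm

lemma homog_isHomogeneous {s : Finset (Fin (n + 1))} {k : ℕ} {F : MvPolynomial (Fin (n + 1)) ℝ}
    (hF : F ∈ homog s k) : F.IsHomogeneous k := by
  intro m hm
  have := (mem_homog_iff.1 hF m (MvPolynomial.mem_support_iff.2 hm)).1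
  rwa [weight_one_eq_degree]

lemma mem_homog_univ_iff {k : ℕ} {F : MvPolynomial (Fin (n + 1)) ℝ} :
    F ∈ homog Finset.univ k ↔ F.IsHomogeneous k := by
  refine ⟨homog_isHomogeneous, fun h => mem_homog_iff.2 fun m hm => ⟨?_, by simp⟩⟩
  have := h (MvPolynomial.mem_support_iff.1 hm)
  rwa [weight_one_eq_degree] at this

lemma finrank_homog (s : Finset (Fin (n + 1))) (k : ℕ) :
    Module.finrank ℝ (homog s k) = (s.card + k - 1).choose k := by
  have e : {m : Fin (n + 1) →₀ ℕ | m.degree = k ∧ m.support ⊆ s} =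
      (s.finsuppAntidiag k : Set (Fin (n + 1) →₀ ℕ)) := by
    ext m
    simp only [Set.mem_ofPred_eq, Finset.mem_coe, Finset.mem_finsuppAntidiag]
    refine and_congr_left fun h => ?_
    rw [Finsupp.degree_apply, Finset.sum_subset h]
    simp
  rw [homog, Module.finrank_eq_nat_card_basis (MvPolynomial.basisRestrictSupport ℝ _), e,
    ← Finset.card_finsuppAntidiag_nat_eq_choose]
  exact Nat.card_eq_card_toFinset _ |>.trans (by simp)

instance (s : Finset (Fin (n + 1))) (k : ℕ) : Module.Finite ℝ (homog s k) := by
  have e : {m : Fin (n + 1) →₀ ℕ | m.degree = k ∧ m.support ⊆ s} ⊆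
      (s.finsuppAntidiag k : Set (Fin (n + 1) →₀ ℕ)) := by
    rintro m ⟨h1, h2⟩
    simp only [Finset.mem_coe, Finset.mem_finsuppAntidiag]
    refine ⟨?_, h2⟩
    rw [← h1, Finsupp.degree_apply, Finset.sum_subset h2]
    simp
  have : Finite {m : Fin (n + 1) →₀ ℕ | m.degree = k ∧ m.support ⊆ s} :=
    (Finset.finite_toSet _).subset e
  exact Module.Finite.of_basis (MvPolynomial.basisRestrictSupport ℝ _)

lemma subst_mem {k : ℕ} {F : MvPolynomial (Fin (n + 1)) ℝ} (hF : F.IsHomogeneous k) :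
    subst K F ∈ MvPolynomial.restrictTotalDegree (Fin n) ℝ k := by
  rw [MvPolynomial.mem_restrictTotalDegree, subst, MvPolynomial.aeval_def, MvPolynomial.eval₂_eq]
  refine MvPolynomial.totalDegree_finsetSum_le fun m hm => ?_
  refine (MvPolynomial.totalDegree_mul _ _).trans ?_
  simp only [MvPolynomial.algebraMap_eq, MvPolynomial.totalDegree_C, zero_add]
  refine (MvPolynomial.totalDegree_finsetProd _ _).trans ?_
  have h := hF (MvPolynomial.mem_support_iff.1 hm)
  rw [weight_one_eq_degree, Finsupp.degree_apply] at h
  rw [← h]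
  refine Finset.sum_le_sum fun i _ => (MvPolynomial.totalDegree_pow _ _).trans ?_
  have := (MvPolynomial.mem_restrictTotalDegree _ _ _).1 (bary_mem K i)
  nlinarith

/-- Every polynomial of degree at most `k` is homogeneous of degree `k` in the barycentric
coordinates, because `∑ λᵢ = 1`. -/
lemma exists_subst_eq {k : ℕ} {p : MvPolynomial (Fin n) ℝ}
    (hp : p ∈ MvPolynomial.restrictTotalDegree (Fin n) ℝ k) :
    ∃ F : MvPolynomial (Fin (n + 1)) ℝ, F.IsHomogeneous k ∧ subst K F = p := by
  have key : MvPolynomial.restrictTotalDegree (Fin n) ℝ k ≤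
      (MvPolynomial.homogeneousSubmodule (Fin (n + 1)) ℝ k).map (subst K).toLinearMap := by
    rw [MvPolynomial.restrictTotalDegree, MvPolynomial.restrictSupport_eq_span, Submodule.span_le]
    rintro _ ⟨m, hm, rfl⟩
    have hm' : m.degree ≤ k := hm
    refine ⟨(∏ i, (∑ j, MvPolynomial.X j * MvPolynomial.C (K.points j i)) ^ m i) *
      (∑ j, MvPolynomial.X j) ^ (k - m.degree), ?_, ?_⟩
    · have h1 : (∏ i, (∑ j, MvPolynomial.X j * MvPolynomial.C (K.points j i)) ^ m i :
          MvPolynomial (Fin (n + 1)) ℝ).IsHomogeneous m.degree := by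
        rw [Finsupp.degree_eq_sum]
        refine MvPolynomial.IsHomogeneous.prod _ _ _ fun i _ => ?_
        have : (∑ j, MvPolynomial.X j * MvPolynomial.C (K.points j i) :
            MvPolynomial (Fin (n + 1)) ℝ).IsHomogeneous 1 :=
          MvPolynomial.IsHomogeneous.sum _ _ _ fun j _ =>
            (MvPolynomial.isHomogeneous_X ℝ j).mul (MvPolynomial.isHomogeneous_C _ _)
        simpa using this.pow (m i)
      have h2 : ((∑ j, MvPolynomial.X j) ^ (k - m.degree) :
          MvPolynomial (Fin (n + 1)) ℝ).IsHomogeneous (k - m.degree) := by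
        have : (∑ j, MvPolynomial.X j : MvPolynomial (Fin (n + 1)) ℝ).IsHomogeneous 1 :=
          MvPolynomial.IsHomogeneous.sum _ _ _ fun j _ => MvPolynomial.isHomogeneous_X ℝ j
        simpa using this.pow (k - m.degree)
      have := h1.mul h2
      rwa [Nat.add_sub_cancel' hm'] at this
    · have h : ∀ c : ℝ, subst K (MvPolynomial.C c) = MvPolynomial.C c := fun c => by
        simp [subst]
      simp only [AlgHom.toLinearMap_apply, map_mul, map_prod, map_pow, map_sum, subst_X, h,
        sum_bary_mul_vertex, sum_bary, one_pow, mul_one]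
      rw [MvPolynomial.monomial_eq, Finsupp.prod_fintype _ _ (by simp)]
      simp
  obtain ⟨F, hF, rfl⟩ := key hp
  exact ⟨F, hF, rfl⟩

/-- A form in the variables indexed by `s` which vanishes on the face with vertices `s` is zero:
by homogeneity it vanishes on a positive orthant. -/
lemma homog_eq_zero {s : Finset (Fin (n + 1))} (hs : s.Nonempty) {k : ℕ}
    {F : MvPolynomial (Fin (n + 1)) ℝ} (hF : F ∈ homog s k)
    (h : ∀ w : Fin (n + 1) → ℝ, (∀ i ∈ s, 0 < w i) → (∀ i ∉ s, w i = 0) → ∑ i, w i = 1 →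
      MvPolynomial.eval w F = 0) : F = 0 := by
  refine MvPolynomial.funext_set (fun _ => Set.Ioi 0) (fun _ => Set.Ioi_infinite 0) fun w hw => ?_
  have hw : ∀ i, 0 < w i := fun i => hw i trivial
  set w' : Fin (n + 1) → ℝ := fun i => if i ∈ s then w i else 0 with hw'
  have e1 : MvPolynomial.eval w F = MvPolynomial.eval w' F := by
    rw [MvPolynomial.eval_eq, MvPolynomial.eval_eq]
    refine Finset.sum_congr rfl fun m hm => ?_
    congr 1
    refine Finset.prod_congr rfl fun i hi => ?_
    simp [hw', (mem_homog_iff.1 hF m hm).2 hi]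
  set S := ∑ i, w' i with hS
  have hSpos : 0 < S := by
    obtain ⟨i, hi⟩ := hs
    refine Finset.sum_pos' (fun j _ => ?_) ⟨i, Finset.mem_univ i, ?_⟩
    · simp only [hw']
      split_ifs
      · exact (hw j).le
      · exact le_rfl
    · simp [hw', hi, hw i]
  have e3 : MvPolynomial.eval w' F = S ^ k * MvPolynomial.eval (fun i => S⁻¹ * w' i) F := by
    rw [MvPolynomial.eval_eq, MvPolynomial.eval_eq, Finset.mul_sum]
    refine Finset.sum_congr rfl fun m hm => ?_
    rw [← (mem_homog_iff.1 hF m hm).1, Finsupp.degree_apply]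
    simp only [mul_pow, Finset.prod_mul_distrib, Finset.prod_pow_eq_pow_sum]
    rw [inv_pow]
    have := pow_ne_zero (∑ i ∈ m.support, m i) hSpos.ne'
    field_simp
  rw [e1, e3, h, mul_zero, map_zero]
  · intro i hi
    simp only [hw', hi, if_true]
    exact mul_pos (inv_pos.2 hSpos) (hw i)
  · intro i hi
    simp [hw', hi]
  · rw [← Finset.mul_sum, ← hS, inv_mul_cancel₀ hSpos.ne']

lemma homog_eq_zero_of_faceSet {ℓ : ℕ} (s : Face n ℓ) {k : ℕ}
    {F : MvPolynomial (Fin (n + 1)) ℝ} (hF : F ∈ homog s.1 k)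
    (h : ∀ x ∈ faceSet K s, MvPolynomial.eval x.ofLp (subst K F) = 0) : F = 0 := by
  refine homog_eq_zero (Finset.card_pos.1 (by rw [s.2]; omega)) hF fun w hw hw0 hw1 => ?_
  have := h (∑ j, w j • K.points j) ((mem_faceSet_iff K s _).2 ?_)
  · rw [eval_subst] at this
    simpa only [coord_sum_smul K hw1] using this
  · simp only [coord_sum_smul K hw1]
    refine ⟨fun i => ?_, hw0⟩
    by_cases hi : i ∈ s.1
    · exact (hw i hi).le
    · exact (hw0 i hi).ge

/-- The part of `F` with monomials in the variables indexed by `s`. -/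
def restrictVars (s : Finset (Fin (n + 1))) (F : MvPolynomial (Fin (n + 1)) ℝ) :
    MvPolynomial (Fin (n + 1)) ℝ :=
  ∑ m ∈ F.support with m.support ⊆ s, MvPolynomial.monomial m (F.coeff m)

lemma coeff_restrictVars (s : Finset (Fin (n + 1))) (F : MvPolynomial (Fin (n + 1)) ℝ)
    (m : Fin (n + 1) →₀ ℕ) :
    (restrictVars s F).coeff m = if m.support ⊆ s then F.coeff m else 0 := by
  simp only [restrictVars, MvPolynomial.coeff_sum, MvPolynomial.coeff_monomial,
    Finset.sum_ite_eq', Finset.mem_filter, MvPolynomial.mem_support_iff]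
  split_ifs <;> simp_all

lemma restrictVars_mem (s : Finset (Fin (n + 1))) {k : ℕ} {F : MvPolynomial (Fin (n + 1)) ℝ}
    (hF : F.IsHomogeneous k) : restrictVars s F ∈ homog s k := by
  refine mem_homog_iff.2 fun m hm => ?_
  rw [MvPolynomial.mem_support_iff, coeff_restrictVars] at hm
  split_ifs at hm with h
  · have := hF hm
    rw [weight_one_eq_degree] at this
    exact ⟨this, h⟩
  · exact absurd rfl hm

lemma eval_restrictVars (s : Finset (Fin (n + 1))) (F : MvPolynomial (Fin (n + 1)) ℝ)
    {w : Fin (n + 1) → ℝ} (hw : ∀ i ∉ s, w i = 0) :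
    MvPolynomial.eval w (restrictVars s F) = MvPolynomial.eval w F := by
  rw [restrictVars, map_sum, MvPolynomial.eval_eq]
  simp only [MvPolynomial.eval_monomial]
  rw [Finset.sum_filter]
  refine Finset.sum_congr rfl fun m _ => ?_
  split_ifs with h
  · rfl
  · obtain ⟨i, hi, his⟩ := Finset.not_subset.1 h
    rw [Finset.prod_eq_zero hi, mul_zero]
    rw [hw i his, zero_pow (Finsupp.mem_support_iff.1 hi)]

lemma eval_subst_restrictVars {ℓ : ℕ} (s : Face n ℓ) (F : MvPolynomial (Fin (n + 1)) ℝ)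
    {x : E n} (hx : x ∈ faceSet K s) :
    MvPolynomial.eval x.ofLp (subst K (restrictVars s.1 F)) =
      MvPolynomial.eval x.ofLp (subst K F) := by
  rw [eval_subst, eval_subst, eval_restrictVars]
  exact ((mem_faceSet_iff K s x).1 hx).2

/-- If a homogeneous polynomial in barycentric coordinates vanishes on a face, then the coefficients
of the monomials in the variables of that face vanish. -/
lemma coeff_eq_zero_of_faceSet {ℓ : ℕ} (s : Face n ℓ) {k : ℕ}
    {F : MvPolynomial (Fin (n + 1)) ℝ} (hF : F.IsHomogeneous k)
    (h : ∀ x ∈ faceSet K s, MvPolynomial.eval x.ofLp (subst K F) = 0)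
    (m : Fin (n + 1) →₀ ℕ) (hm : m.support ⊆ s.1) : F.coeff m = 0 := by
  have h0 := homog_eq_zero_of_faceSet K s (restrictVars_mem s.1 hF) fun x hx => by
    rw [eval_subst_restrictVars K s F hx, h x hx]
  have := coeff_restrictVars s.1 F m
  rw [h0, if_pos hm] at this
  simpa using this.symm

/-- A polynomial vanishing on the simplex is zero. -/
lemma eq_zero_of_closedInterior {p : MvPolynomial (Fin n) ℝ}
    (h : ∀ x ∈ K.closedInterior, MvPolynomial.eval x.ofLp p = 0) : p = 0 := by
  obtain ⟨F, hF, rfl⟩ := exists_subst_eq K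
    ((MvPolynomial.mem_restrictTotalDegree _ _ p).2 le_rfl)
  have : F = 0 := by
    refine homog_eq_zero_of_faceSet K (⟨Finset.univ, by simp⟩ : Face n n)
      (mem_homog_univ_iff.2 hF) fun x hx => h x ?_
    rw [mem_closedInterior_iff]
    exact ((mem_faceSet_iff K _ x).1 hx).1
  rw [this, map_zero]

/-- If every monomial of `F` involves all the variables indexed by `s`, then `F` is divisible by
their product. -/
lemma exists_eq_prod_mul {s t : Finset (Fin (n + 1))} {k : ℕ}
    {F : MvPolynomial (Fin (n + 1)) ℝ} (hF : F ∈ homog t k)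
    (h : ∀ m ∈ F.support, s ⊆ m.support) :
    ∃ G ∈ homog t (k - s.card), F = (∏ i ∈ s, MvPolynomial.X i) * G := by
  set e : Fin (n + 1) →₀ ℕ := ∑ i ∈ s, Finsupp.single i 1 with he
  have hei : ∀ i, e i = if i ∈ s then 1 else 0 := fun i => by
    simp [he, Finsupp.finsetSum_apply, Finsupp.single_apply]
  have hX : (∏ i ∈ s, MvPolynomial.X i : MvPolynomial (Fin (n + 1)) ℝ) =
      MvPolynomial.monomial e 1 := by
    rw [he, MvPolynomial.monomial_sum_one]
    rfl
  have hdeg : e.degree = s.card := by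
    simp [he]
  refine ⟨F.divMonomial e, mem_homog_iff.2 fun m hm => ?_, ?_⟩
  · rw [MvPolynomial.mem_support_iff, MvPolynomial.coeff_divMonomial] at hm
    have := mem_homog_iff.1 hF _ (MvPolynomial.mem_support_iff.2 hm)
    rw [map_add, hdeg] at this
    refine ⟨by omega, subset_trans (fun i hi => ?_) this.2⟩
    rw [Finsupp.mem_support_iff] at hi ⊢
    simp [hi]
  · have h1 := F.divMonomial_add_modMonomial e
    have h2 : F.modMonomial e = 0 := by
      ext m
      rw [MvPolynomial.coeff_zero]
      by_cases hm : e ≤ m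
      · exact MvPolynomial.coeff_modMonomial_of_le _ hm
      · rw [MvPolynomial.coeff_modMonomial_of_not_le _ hm]
        by_contra h0
        refine hm fun i => ?_
        rw [hei]
        split_ifs with hi
        · have := h m (MvPolynomial.mem_support_iff.2 h0) hi
          rw [Finsupp.mem_support_iff] at this
          omega
        · exact Nat.zero_le _
    rw [hX]
    rw [h2, add_zero] at h1
    exact h1.symm

/-- A polynomial of degree at most `k` vanishing on all proper sub-simplices of `△` with
vertices `s` (but the empty one) is on `△` the product of the barycentric coordinates of `△` and
of a polynomial of degree at most `k - |s|`. -/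
lemma exists_bubble_on_face {ℓ : ℕ} (s : Face n ℓ) {k : ℕ} (hk : 1 ≤ k)
    {p : MvPolynomial (Fin n) ℝ} (hp : p ∈ MvPolynomial.restrictTotalDegree (Fin n) ℝ k)
    (h : ∀ (r : ℕ) (t : Face n r), t.1 ⊂ s.1 →
      ∀ x ∈ faceSet K t, MvPolynomial.eval x.ofLp p = 0) :
    ∃ G ∈ homog s.1 (k - (ℓ + 1)), ∀ x ∈ faceSet K s, MvPolynomial.eval x.ofLp p =
      MvPolynomial.eval x.ofLp (subst K ((∏ i ∈ s.1, MvPolynomial.X i) * G)) := by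
  obtain ⟨F, hF, rfl⟩ := exists_subst_eq K hp
  obtain ⟨G, hG, hFG⟩ := exists_eq_prod_mul (s := s.1) (restrictVars_mem s.1 hF) fun m hm => by
    have hm' := (mem_homog_iff.1 (restrictVars_mem s.1 hF) m hm)
    rw [MvPolynomial.mem_support_iff, coeff_restrictVars, if_pos hm'.2] at hm
    by_contra hs
    refine hm ?_
    have hne : m.support.Nonempty := by
      rw [Finset.nonempty_iff_ne_empty, Ne, Finsupp.support_eq_empty]
      rintro rfl
      simp at hm'
      omega
    exact coeff_eq_zero_of_faceSet K (⟨m.support, by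
      have := Finset.card_pos.2 hne; omega⟩ : Face n (m.support.card - 1)) hF
      (h _ _ ⟨hm'.2, hs⟩) m subset_rfl
  refine ⟨G, by rwa [s.2] at hG, fun x hx => ?_⟩
  rw [← hFG, eval_subst_restrictVars K s F hx]

/-- A polynomial vanishing on the facets opposite to two vertices is divisible by the product of
the corresponding barycentric coordinates. -/
lemma exists_eq_bary_mul_bary_mul (hn : 1 ≤ n) {i j : Fin (n + 1)} (hij : i ≠ j) {k : ℕ}
    {p : MvPolynomial (Fin n) ℝ} (hp : p ∈ MvPolynomial.restrictTotalDegree (Fin n) ℝ k)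
    (h : ∀ (s : Face n (n - 1)), (i ∉ s.1 ∨ j ∉ s.1) →
      ∀ x ∈ faceSet K s, MvPolynomial.eval x.ofLp p = 0) :
    ∃ q ∈ MvPolynomial.restrictTotalDegree (Fin n) ℝ (k - 2), p = bary K i * bary K j * q := by
  obtain ⟨F, hF, rfl⟩ := exists_subst_eq K hp
  have hvan : ∀ a : Fin (n + 1), (a = i ∨ a = j) → ∀ m ∈ F.support, a ∈ m.support := by
    intro a ha m hm
    by_contra hma
    refine MvPolynomial.mem_support_iff.1 hm ?_
    refine coeff_eq_zero_of_faceSet K (⟨Finset.univ.erase a, by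
      rw [Finset.card_erase_of_mem (Finset.mem_univ a), Finset.card_univ, Fintype.card_fin]
      omega⟩ : Face n (n - 1)) hF (h _ ?_) m fun b hb => ?_
    · rcases ha with rfl | rfl <;> simp
    · refine Finset.mem_erase.2 ⟨?_, Finset.mem_univ b⟩
      rintro rfl
      exact hma hb
  obtain ⟨G, hG, rfl⟩ := exists_eq_prod_mul (s := {i, j}) (mem_homog_univ_iff.2 hF)
    fun m hm a ha => hvan a (by simpa using ha) m hm
  rw [Finset.card_pair hij] at hG
  refine ⟨subst K G, subst_mem K (homog_isHomogeneous hG), ?_⟩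
  rw [Finset.prod_pair hij]
  simp

lemma map_subst_homog_univ (k : ℕ) :
    (homog Finset.univ k).map (subst K).toLinearMap =
      MvPolynomial.restrictTotalDegree (Fin n) ℝ k := by
  apply le_antisymm
  · rintro _ ⟨F, hF, rfl⟩
    exact subst_mem K (homog_isHomogeneous hF)
  · intro p hp
    obtain ⟨F, hF, rfl⟩ := exists_subst_eq K hp
    exact ⟨F, mem_homog_univ_iff.2 hF, rfl⟩

lemma facePoly_eq_map {ℓ : ℕ} (s : Face n ℓ) (k : ℕ) :
    facePoly K s k = (homog s.1 k).map (restrictTo (faceSet K s) ∘ₗ (subst K).toLinearMap) := by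
  rw [Submodule.map_comp, facePoly]
  apply le_antisymm
  · rintro _ ⟨p, hp, rfl⟩
    obtain ⟨F, hF, rfl⟩ := exists_subst_eq K hp
    refine ⟨_, ⟨_, restrictVars_mem s.1 hF, rfl⟩, ?_⟩
    funext x
    simpa [restrictTo] using eval_subst_restrictVars K s F x.2
  · refine Submodule.map_mono ?_
    rintro _ ⟨F, hF, rfl⟩
    exact subst_mem K (homog_isHomogeneous hF)

lemma finrank_map_homog {V : Type*} [AddCommGroup V] [Module ℝ V] {s : Finset (Fin (n + 1))}
    {k ℓ : ℕ} (hs : s.card = ℓ + 1) (f : MvPolynomial (Fin (n + 1)) ℝ →ₗ[ℝ] V)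
    (hf : ∀ F ∈ homog s k, f F = 0 → F = 0) :
    Module.finrank ℝ ((homog s k).map f) = (ℓ + k).choose k := by
  have hinj : Function.Injective (f.domRestrict (homog s k)) := by
    rw [← LinearMap.ker_eq_bot, LinearMap.ker_eq_bot']
    exact fun F hF => Subtype.ext (hf F.1 F.2 hF)
  rw [← LinearMap.range_domRestrict, LinearMap.finrank_range_of_inj hinj, finrank_homog, hs]
  congr 1
  omega

lemma finrank_facePoly {ℓ : ℕ} (s : Face n ℓ) (k : ℕ) :
    Module.finrank ℝ (facePoly K s k) = (ℓ + k).choose k := by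
  rw [facePoly_eq_map]
  refine finrank_map_homog s.2 _ fun F hF h0 => homog_eq_zero_of_faceSet K s hF fun x hx => ?_
  simpa [restrictTo] using congrFun h0 ⟨x, hx⟩

lemma finrank_restrictTotalDegree (K : Affine.Simplex ℝ (E n) n) (k : ℕ) :
    Module.finrank ℝ (MvPolynomial.restrictTotalDegree (Fin n) ℝ k) = (n + k).choose k := by
  rw [← map_subst_homog_univ K]
  refine finrank_map_homog (by simp) _ fun F hF h0 => ?_
  refine homog_eq_zero_of_faceSet K (⟨Finset.univ, by simp⟩ : Face n n) hF fun x _ => ?_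
  rw [← AlgHom.toLinearMap_apply, h0, map_zero]

end Bernstein

/-! ### Integration over a simplex -/

section Integration

open scoped Topology
open Filter

lemma eq_zero_of_setIntegral_eq_zero {d : ℕ} {S : Set (E d)} (hS : IsCompact S)
    (hSi : S ⊆ closure (interior S)) {g : E d → ℝ} (hg : Continuous g) (h0 : ∀ x ∈ S, 0 ≤ g x)
    (hint : ∫ x in S, g x = 0) : ∀ x ∈ S, g x = 0 := by
  have h1 : 0 ≤ᵐ[volume.restrict S] g :=
    (ae_restrict_iff' hS.measurableSet).2 (Eventually.of_forall h0)
  have h2 :=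
    (setIntegral_eq_zero_iff_of_nonneg_ae h1 (hg.continuousOn.integrableOn_compact hS)).1 hint
  have h3 : g =ᵐ[volume.restrict (interior S)] 0 :=
    ae_restrict_of_ae_restrict_of_subset interior_subset h2
  have h4 : Set.EqOn g 0 (interior S) :=
    Measure.eqOn_open_of_ae_eq h3 isOpen_interior hg.continuousOn continuousOn_const
  exact fun x hx => h4.closure hg continuous_const (hSi hx)

/-- A simplex of dimension `d` is an isometric copy of a compact convex body of `ℝᵈ`. -/
lemma exists_isometry_image_eq {n d : ℕ} (T : Affine.Simplex ℝ (E n) d) :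
    ∃ (e : E d → E n) (S : Set (E d)), Isometry e ∧ IsCompact S ∧ S ⊆ closure (interior S) ∧
      S.Nonempty ∧ T.closedInterior = e '' S := by
  set V := vectorSpan ℝ (Set.range T.points) with hV
  have hfin : Module.finrank ℝ V = d := T.independent.finrank_vectorSpan (by simp)
  set b := (stdOrthonormalBasis ℝ V).reindex (finCongr hfin)
  set L : E d →ₗᵢ[ℝ] E n := V.subtypeₗᵢ.comp b.repr.symm.toLinearIsometry with hL
  set e : E d →ᵃ[ℝ] E n := L.toLinearMap.toAffineMap + AffineMap.const ℝ _ (T.points 0) with he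
  have hee : ∀ y, e y = L y + T.points 0 := fun y => rfl
  have hiso : Isometry e := (isometry_add_right (T.points 0)).comp L.isometry
  have hmem : ∀ i, T.points i -ᵥ T.points 0 ∈ V := fun i =>
    vsub_mem_vectorSpan ℝ (Set.mem_range_self i) (Set.mem_range_self 0)
  set P : Fin (d + 1) → E d := fun i => b.repr ⟨T.points i -ᵥ T.points 0, hmem i⟩ with hP
  have heP : ∀ i, e (P i) = T.points i := fun i => by
    simp [hee, hP, hL]
  have hind : AffineIndependent ℝ P := by
    refine AffineIndependent.of_comp e ?_
    have : e ∘ P = T.points := funext heP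
    rw [this]
    exact T.independent
  let T' : Affine.Simplex ℝ (E d) d := ⟨P, hind⟩
  have hmap : T'.map e hiso.injective = T := Affine.Simplex.ext heP
  have hne : (interior T'.closedInterior).Nonempty := by
    rw [← Affine.Simplex.convexHull_eq_closedInterior,
      interior_convexHull_nonempty_iff_affineSpan_eq_top]
    exact (vertexBasis T').tot'
  have hconv : Convex ℝ T'.closedInterior := by
    rw [← Affine.Simplex.convexHull_eq_closedInterior]
    exact convex_convexHull ℝ _
  refine ⟨e, T'.closedInterior, hiso, T'.isCompact_closedInterior, ?_,
    T'.nonempty_closedInterior, ?_⟩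
  · rw [hconv.closure_interior_eq_closure_of_nonempty_interior hne]
    exact subset_closure
  · rw [← Affine.Simplex.closedInterior_map T' hiso.injective, hmap]

lemma restrict_image_isometry {n d : ℕ} {e : E d → E n} (he : Isometry e) {S : Set (E d)}
    (hS : IsCompact S) :
    (μHE[d] : Measure (E n)).restrict (e '' S) = (volume.restrict S).map e := by
  have h := he.map_euclideanHausdorffMeasure (d := d)
  rw [EuclideanSpace.euclideanHausdorffMeasure_eq_volume] at h
  have hm : MeasurableSet (e '' S) := (hS.image he.continuous).measurableSet
  have h1 : (μHE[d] : Measure (E n)).restrict (e '' S) =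
      ((μHE[d] : Measure (E n)).restrict (Set.range e)).restrict (e '' S) := by
    rw [Measure.restrict_restrict hm, Set.inter_eq_left.2 (Set.image_subset_range e S)]
  rw [h1, ← h, Measure.restrict_map he.continuous.measurable hm, he.injective.preimage_image]

variable {n d : ℕ} (T : Affine.Simplex ℝ (E n) d)

lemma integrable_simplex {g : E n → ℝ} (hg : Continuous g) :
    IntegrableOn g T.closedInterior μHE[d] := by
  obtain ⟨e, S, he, hS, -, -, hT⟩ := exists_isometry_image_eq T
  rw [IntegrableOn, hT, restrict_image_isometry he hS,
    he.isClosedEmbedding.measurableEmbedding.integrable_map_iff]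
  exact (hg.comp he.continuous).continuousOn.integrableOn_compact hS

lemma measure_simplex : μHE[d] T.closedInterior ≠ 0 ∧ μHE[d] T.closedInterior ≠ ⊤ := by
  obtain ⟨e, S, he, hS, hSi, hne, hT⟩ := exists_isometry_image_eq T
  rw [hT, he.euclideanHausdorffMeasure_image, EuclideanSpace.euclideanHausdorffMeasure_eq_volume]
  refine ⟨fun h => ?_, hS.measure_lt_top.ne⟩
  have : (interior S).Nonempty := by
    obtain ⟨x, hx⟩ := hne
    by_contra h0
    rw [Set.not_nonempty_iff_eq_empty] at h0
    simpa [h0] using hSi hx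
  exact (isOpen_interior.measure_pos volume this).ne' (measure_mono_null interior_subset h)

lemma eq_zero_of_integral_simplex {g : E n → ℝ} (hg : Continuous g)
    (h0 : ∀ x ∈ T.closedInterior, 0 ≤ g x) (hint : ∫ x in T.closedInterior, g x ∂μHE[d] = 0) :
    ∀ x ∈ T.closedInterior, g x = 0 := by
  obtain ⟨e, S, he, hS, hSi, -, hT⟩ := exists_isometry_image_eq T
  rw [hT, restrict_image_isometry he hS,
    he.isClosedEmbedding.measurableEmbedding.integral_map] at hint
  rw [hT] at h0 ⊢
  rintro _ ⟨y, hy, rfl⟩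
  exact eq_zero_of_setIntegral_eq_zero hS hSi (hg.comp he.continuous)
    (fun z hz => h0 _ ⟨z, hz, rfl⟩) hint y hy

lemma continuous_eval (p : MvPolynomial (Fin n) ℝ) :
    Continuous fun x : E n => MvPolynomial.eval x.ofLp p :=
  (MvPolynomial.continuous_eval p).comp (PiLp.continuous_ofLp 2 _)

/-- The integral of a polynomial over an `n`-simplex in `ℝⁿ`. -/
def polyIntegral (K : Affine.Simplex ℝ (E n) n) : MvPolynomial (Fin n) ℝ →ₗ[ℝ] ℝ where
  toFun p := ∫ x in K.closedInterior, MvPolynomial.eval x.ofLp p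
  map_add' p q := by
    simp only [map_add]
    have h := fun p => integrable_simplex K (continuous_eval p)
    simp only [EuclideanSpace.euclideanHausdorffMeasure_eq_volume] at h
    exact integral_add (h p) (h q)
  map_smul' c p := by
    simp only [MvPolynomial.smul_eval, RingHom.id_apply, smul_eq_mul]
    exact integral_const_mul _ _

lemma polyIntegral_apply (K : Affine.Simplex ℝ (E n) n) (p : MvPolynomial (Fin n) ℝ) :
    polyIntegral K p = ∫ x in K.closedInterior, MvPolynomial.eval x.ofLp p := rfl

lemma eq_zero_of_polyIntegral (K : Affine.Simplex ℝ (E n) n) {p : MvPolynomial (Fin n) ℝ}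
    (h0 : ∀ x ∈ K.closedInterior, 0 ≤ MvPolynomial.eval x.ofLp p) (h : polyIntegral K p = 0) :
    p = 0 := by
  refine eq_zero_of_closedInterior K (eq_zero_of_integral_simplex K (continuous_eval p) h0 ?_)
  rwa [EuclideanSpace.euclideanHausdorffMeasure_eq_volume]

/-- The derivative of a polynomial in the direction of the vector `t`. -/
def dirDeriv (t : Fin n → ℝ) (p : MvPolynomial (Fin n) ℝ) : MvPolynomial (Fin n) ℝ :=
  ∑ k, MvPolynomial.C (t k) * MvPolynomial.pderiv k p

lemma dirDeriv_add (t : Fin n → ℝ) (p q : MvPolynomial (Fin n) ℝ) :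
    dirDeriv t (p + q) = dirDeriv t p + dirDeriv t q := by
  simp [dirDeriv, mul_add, Finset.sum_add_distrib]

lemma dirDeriv_mul (t : Fin n → ℝ) (p q : MvPolynomial (Fin n) ℝ) :
    dirDeriv t (p * q) = dirDeriv t p * q + p * dirDeriv t q := by
  simp only [dirDeriv, MvPolynomial.pderiv_mul, Finset.sum_mul, Finset.mul_sum,
    ← Finset.sum_add_distrib]
  exact Finset.sum_congr rfl fun k _ => by ring

lemma hasDerivAt_eval_line (t : E n) (p : MvPolynomial (Fin n) ℝ) (x : E n) (s : ℝ) :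
    HasDerivAt (fun s : ℝ => MvPolynomial.eval (x + s • t).ofLp p)
      (MvPolynomial.eval (x + s • t).ofLp (dirDeriv t.ofLp p)) s := by
  induction p using MvPolynomial.induction_on with
  | C a => simpa [dirDeriv] using hasDerivAt_const s a
  | add p q hp hq =>
    simp only [dirDeriv_add, map_add]
    exact hp.add hq
  | mul_X p i hp =>
    have h1 : HasDerivAt (fun s : ℝ => MvPolynomial.eval (x + s • t).ofLp
        (MvPolynomial.X i : MvPolynomial (Fin n) ℝ)) (t i) s := by
      simpa using ((hasDerivAt_id s).mul_const (t i)).const_add (x i)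
    have h2 : MvPolynomial.eval (x + s • t).ofLp (dirDeriv t.ofLp (MvPolynomial.X i)) = t i := by
      simp [dirDeriv, MvPolynomial.pderiv_X, Pi.single_apply]
    have := hp.mul h1
    rw [← h2] at this
    simp only [dirDeriv_mul, map_mul, map_add]
    exact this

/-- The integral over `K` of the derivative of `λᵢ λⱼ p` along the edge `xᵢ xⱼ` vanishes. Extended
by zero, `λᵢ λⱼ p` is Lipschitz along this edge, as the facets which are not parallel to the edge are
`λᵢ = 0` and `λⱼ = 0`; its difference quotients have integral zero by translation invariance. -/
lemma polyIntegral_dirDeriv_edge (K : Affine.Simplex ℝ (E n) n) {i j : Fin (n + 1)} (hij : i ≠ j)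
    (p : MvPolynomial (Fin n) ℝ) :
    polyIntegral K (dirDeriv (edge K i j) (bary K i * bary K j * p)) = 0 := by
  set t : E n := K.points i - K.points j with ht
  have hte : edge K i j = t.ofLp := rfl
  set P := bary K i * bary K j * p with hP
  set S := K.closedInterior with hS
  set f : E n → ℝ := fun x => MvPolynomial.eval x.ofLp P with hf
  set D : E n → ℝ := fun x => MvPolynomial.eval x.ofLp (dirDeriv t.ofLp P) with hD
  set F : E n → ℝ := S.indicator f with hF
  have hScomp : IsCompact S := K.isCompact_closedInterior
  have hSm : MeasurableSet S := hScomp.measurableSet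
  have hSconv : Convex ℝ S := by
    rw [hS, ← Affine.Simplex.convexHull_eq_closedInterior]
    exact convex_convexHull ℝ _
  obtain ⟨M, hM⟩ := hScomp.exists_bound_of_continuousOn (continuous_eval p).continuousOn
  obtain ⟨N, hN⟩ := hScomp.exists_bound_of_continuousOn
    (continuous_eval (dirDeriv t.ofLp P)).continuousOn
  obtain ⟨R, hR⟩ := hScomp.isBounded.subset_closedBall 0
  obtain ⟨x₀, hx₀⟩ : S.Nonempty := K.nonempty_closedInterior
  have hM0 : 0 ≤ M := (norm_nonneg _).trans (hM x₀ hx₀)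
  have hN0 : 0 ≤ N := (norm_nonneg _).trans (hN x₀ hx₀)
  -- along the edge only the barycentric coordinates `λᵢ` and `λⱼ` vary
  have hcoord : ∀ (a : Fin (n + 1)) (x : E n) (h : ℝ), (vertexBasis K).coord a (x + h • t) =
      (vertexBasis K).coord a x + h * ((if a = i then 1 else 0) - if a = j then 1 else 0) := by
    intro a x h
    have h1 := ((vertexBasis K).coord a).map_vadd x (h • t)
    rw [vadd_eq_add, vadd_eq_add, map_smul, coord_linear_apply] at h1
    rw [add_comm x, h1, ← sum_baryGrad_mul_edge, smul_eq_mul]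
    exact add_comm _ _
  have hle1 : ∀ x ∈ S, ∀ a, (vertexBasis K).coord a x ≤ 1 := fun x hx a => by
    rw [← (vertexBasis K).sum_coord_apply_eq_one x]
    exact Finset.single_le_sum (fun b _ => (mem_closedInterior_iff K x).1 hx b) (Finset.mem_univ a)
  have hfeval : ∀ x, f x = (vertexBasis K).coord i x * (vertexBasis K).coord j x *
      MvPolynomial.eval x.ofLp p := fun x => by simp [hf, hP]
  have hfsmall : ∀ x ∈ S, ∀ h : ℝ,
      ((vertexBasis K).coord i x ≤ h ∨ (vertexBasis K).coord j x ≤ h) → |f x| ≤ h * M := by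
    intro x hx h hh
    have hi := (mem_closedInterior_iff K x).1 hx i
    have hj := (mem_closedInterior_iff K x).1 hx j
    have hi1 := hle1 x hx i
    have hj1 := hle1 x hx j
    have hp := hM x hx
    rw [Real.norm_eq_abs] at hp
    rw [hfeval, abs_mul, abs_of_nonneg (mul_nonneg hi hj)]
    have : (vertexBasis K).coord i x * (vertexBasis K).coord j x ≤ h := by
      rcases hh with hh | hh <;> nlinarith
    exact mul_le_mul this hp (abs_nonneg _) ((mul_nonneg hi hj).trans this)
  have hbound : ∀ h : ℝ, 0 < h → ∀ x, |F (x + h • t) - F x| ≤ h * (M + N) := by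
    intro h hh x
    by_cases hx : x ∈ S <;> by_cases hx' : x + h • t ∈ S
    -- both points in `K`: mean value inequality
    · have hseg : ∀ s ∈ Set.Icc 0 h, x + s • t ∈ S := by
        intro s hs
        have := hSconv.add_smul_sub_mem hx hx' (t := s / h)
          ⟨div_nonneg hs.1 hh.le, (div_le_one hh).2 hs.2⟩
        rwa [add_sub_cancel_left, smul_smul, div_mul_cancel₀ _ hh.ne'] at this
      have := (convex_Icc (0 : ℝ) h).norm_image_sub_le_of_norm_hasDerivWithin_le
        (f := fun s => f (x + s • t)) (C := N)
        (fun s hs => (hasDerivAt_eval_line t P x s).hasDerivWithinAt)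
        (fun s hs => hN _ (hseg s hs)) (Set.left_mem_Icc.2 hh.le) (Set.right_mem_Icc.2 hh.le)
      simp only [zero_smul, add_zero, sub_zero, Real.norm_eq_abs, abs_of_pos hh] at this
      rw [hF, Set.indicator_of_mem hx, Set.indicator_of_mem hx']
      nlinarith
    -- the segment leaves `K` through the facet `λⱼ = 0`, so that `λⱼ ≤ h` at its origin
    · rw [hF, Set.indicator_of_mem hx, Set.indicator_of_notMem hx', zero_sub, abs_neg]
      refine (hfsmall x hx h (Or.inr ?_)).trans (by nlinarith)
      by_contra hlt
      refine hx' ((mem_closedInterior_iff K _).2 fun a => ?_)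
      rw [hcoord]
      have := (mem_closedInterior_iff K x).1 hx a
      split_ifs with h1 h2 h2
      · exact absurd (h1.symm.trans h2) hij
      · linarith
      · subst h2; linarith
      · linarith
    -- the segment enters `K` through the facet `λᵢ = 0`, so that `λᵢ ≤ h` at its end
    · rw [hF, Set.indicator_of_notMem hx, Set.indicator_of_mem hx', sub_zero]
      refine (hfsmall _ hx' h (Or.inl ?_)).trans (by nlinarith)
      by_contra hlt
      refine hx ((mem_closedInterior_iff K _).2 fun a => ?_)
      have := (mem_closedInterior_iff K _).1 hx' a
      rw [hcoord] at this hlt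
      split_ifs at this with h1 h2 h2
      · exact absurd (h1.symm.trans h2) hij
      · subst h1
        simp [hij] at hlt
        linarith
      · linarith
      · linarith
    · rw [hF, Set.indicator_of_notMem hx, Set.indicator_of_notMem hx', sub_zero, abs_zero]
      positivity
  have hFint : Integrable F := by
    rw [hF, integrable_indicator_iff hSm]
    exact (continuous_eval P).continuousOn.integrableOn_compact hScomp
  set u : ℕ → ℝ := fun m => 1 / ((m : ℝ) + 1) with hu
  have hupos : ∀ m, 0 < u m := fun m => by positivity
  have hule : ∀ m, u m ≤ 1 := fun m => by
    rw [hu, div_le_one (by positivity)]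
    linarith [(Nat.cast_nonneg m : (0 : ℝ) ≤ m)]
  have hulim : Tendsto u atTop (𝓝 0) := tendsto_one_div_add_atTop_nhds_zero_nat
  set Q : ℕ → E n → ℝ := fun m x => (u m)⁻¹ * (F (x + u m • t) - F x) with hQ
  have hQint : ∀ m, ∫ x, Q m x = 0 := by
    intro m
    rw [hQ]
    simp only
    rw [integral_const_mul, integral_sub (hFint.comp_add_right _) hFint,
      integral_add_right_eq_self, sub_self, mul_zero]
  have hlim : Tendsto (fun m => ∫ x, Q m x) atTop (𝓝 (∫ x, S.indicator D x)) := by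
    refine tendsto_integral_of_dominated_convergence
      ((Metric.closedBall (0 : E n) (R + ‖t‖)).indicator fun _ => M + N) (fun m => ?_) ?_
      (fun m => Eventually.of_forall fun x => ?_) ?_
    · exact (((hFint.comp_add_right _).sub hFint).const_mul _).aestronglyMeasurable
    · rw [integrable_indicator_iff Metric.isClosed_closedBall.measurableSet]
      exact continuousOn_const.integrableOn_compact (isCompact_closedBall _ _)
    · by_cases hx : x ∈ Metric.closedBall (0 : E n) (R + ‖t‖)
      · rw [Set.indicator_of_mem hx, hQ, Real.norm_eq_abs, abs_mul,
          abs_of_pos (inv_pos.2 (hupos m)), inv_mul_le_iff₀ (hupos m)]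
        exact hbound _ (hupos m) x
      · rw [Set.indicator_of_notMem hx]
        rw [mem_closedBall_zero_iff, not_le] at hx
        have h1 : x ∉ S := fun h => by
          have := mem_closedBall_zero_iff.1 (hR h)
          linarith [norm_nonneg t]
        have h2 : x + u m • t ∉ S := fun h => by
          have h3 := mem_closedBall_zero_iff.1 (hR h)
          have h4 := norm_sub_le (x + u m • t) (u m • t)
          rw [add_sub_cancel_right, norm_smul, Real.norm_eq_abs, abs_of_pos (hupos m)] at h4
          nlinarith [norm_nonneg t, hule m]
        simp [hQ, hF, h1, h2]
    -- off the boundary of `K`, a null set, the difference quotients converge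
    · have hfr : ∀ᵐ x : E n, x ∉ frontier S := by
        rw [ae_iff]
        simpa using hSconv.addHaar_frontier volume
      filter_upwards [hfr] with x hx
      have hshift : Tendsto (fun m => x + u m • t) atTop (𝓝 x) := by
        simpa using (hulim.smul_const t).const_add x
      by_cases hxS : x ∈ S
      · have hxi : x ∈ interior S := by
          by_contra h
          exact hx ⟨subset_closure hxS, h⟩
        rw [Set.indicator_of_mem hxS]
        have hd := hasDerivAt_iff_tendsto_slope_zero.1 (hasDerivAt_eval_line t P x 0)
        have hu0 : Tendsto u atTop (𝓝[≠] 0) :=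
          tendsto_nhdsWithin_iff.2 ⟨hulim, Eventually.of_forall fun m => (hupos m).ne'⟩
        have := hd.comp hu0
        simp only [zero_smul, add_zero, zero_add] at this
        refine this.congr' ?_
        filter_upwards [hshift.eventually (isOpen_interior.mem_nhds hxi)] with m hm
        simp [hQ, hF, hf, hxS, interior_subset hm]
      · rw [Set.indicator_of_notMem hxS]
        refine tendsto_const_nhds.congr' ?_
        filter_upwards [hshift.eventually (hScomp.isClosed.isOpen_compl.mem_nhds hxS)] with m hm
        have hm' : x + u m • t ∉ S := hm
        simp [hQ, hF, hxS, hm']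
  simp only [hQint] at hlim
  have h0 := tendsto_nhds_unique hlim tendsto_const_nhds
  rw [integral_indicator hSm] at h0
  rw [polyIntegral_apply, hte]
  exact h0

end Integration

/-! ### Polynomial fields and the enriched space -/

section Fields

variable {n : ℕ}

lemma pderiv_mem_restrictSupport {S T : Set (Fin n →₀ ℕ)} {i : Fin n}
    (h : ∀ m, m + Finsupp.single i 1 ∈ S → m ∈ T) {p : MvPolynomial (Fin n) ℝ}
    (hp : p ∈ MvPolynomial.restrictSupport ℝ S) :
    MvPolynomial.pderiv i p ∈ MvPolynomial.restrictSupport ℝ T := by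
  rw [MvPolynomial.mem_restrictSupport_iff] at hp ⊢
  intro m hm
  refine h m (hp ?_)
  rw [Finset.mem_coe, MvPolynomial.mem_support_iff] at hm ⊢
  rw [MvPolynomial.coeff_pderiv] at hm
  exact left_ne_zero_of_mul hm

lemma restrictTotalDegree_eq (k : ℕ) : MvPolynomial.restrictTotalDegree (Fin n) ℝ k =
    MvPolynomial.restrictSupport ℝ {m : Fin n →₀ ℕ | m.degree ≤ k} := rfl

lemma restrictTotalDegree_mono {k l : ℕ} (h : k ≤ l) :
    MvPolynomial.restrictTotalDegree (Fin n) ℝ k ≤ MvPolynomial.restrictTotalDegree (Fin n) ℝ l :=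
  MvPolynomial.restrictSupport_mono ℝ fun _ hm => le_trans hm h

lemma pderiv_mem {k : ℕ} (i : Fin n) {p : MvPolynomial (Fin n) ℝ}
    (hp : p ∈ MvPolynomial.restrictTotalDegree (Fin n) ℝ (k + 1)) :
    MvPolynomial.pderiv i p ∈ MvPolynomial.restrictTotalDegree (Fin n) ℝ k := by
  refine pderiv_mem_restrictSupport (fun m hm => ?_) hp
  have : (m + Finsupp.single i 1).degree ≤ k + 1 := hm
  rw [map_add, Finsupp.degree_single] at this
  exact Nat.le_of_succ_le_succ this

lemma mul_mem_restrictTotalDegree {k l : ℕ} {p q : MvPolynomial (Fin n) ℝ}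
    (hp : p ∈ MvPolynomial.restrictTotalDegree (Fin n) ℝ k)
    (hq : q ∈ MvPolynomial.restrictTotalDegree (Fin n) ℝ l) :
    p * q ∈ MvPolynomial.restrictTotalDegree (Fin n) ℝ (k + l) := by
  rw [MvPolynomial.mem_restrictTotalDegree] at *
  exact (MvPolynomial.totalDegree_mul _ _).trans (add_le_add hp hq)

lemma C_mul_mem_restrictTotalDegree {k : ℕ} (c : ℝ) {p : MvPolynomial (Fin n) ℝ}
    (hp : p ∈ MvPolynomial.restrictTotalDegree (Fin n) ℝ k) :
    MvPolynomial.C c * p ∈ MvPolynomial.restrictTotalDegree (Fin n) ℝ k := by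
  rw [← MvPolynomial.smul_eq_C_mul]
  exact Submodule.smul_mem _ c hp

lemma dirDeriv_mem {k : ℕ} (t : Fin n → ℝ) {p : MvPolynomial (Fin n) ℝ}
    (hp : p ∈ MvPolynomial.restrictTotalDegree (Fin n) ℝ (k + 1)) :
    dirDeriv t p ∈ MvPolynomial.restrictTotalDegree (Fin n) ℝ k :=
  Submodule.sum_mem _ fun i _ => C_mul_mem_restrictTotalDegree _ (pderiv_mem i hp)

/-- The row-wise divergence as a linear map. -/
def divL (n : ℕ) : MatField n →ₗ[ℝ] (Fin n → MvPolynomial (Fin n) ℝ) where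
  toFun := divergence
  map_add' a b := by
    funext i
    simp [divergence, Finset.sum_add_distrib]
  map_smul' c a := by
    funext i
    simp [divergence, Finset.smul_sum]

@[simp] lemma divL_apply (τ : MatField n) : divL n τ = divergence τ := rfl

lemma divergence_mem {k : ℕ} {τ : MatField n}
    (hτ : ∀ i j, τ i j ∈ MvPolynomial.restrictTotalDegree (Fin n) ℝ (k + 1)) (i : Fin n) :
    divergence τ i ∈ MvPolynomial.restrictTotalDegree (Fin n) ℝ k :=
  Submodule.sum_mem _ fun j _ => pderiv_mem j (hτ i j)

/-- The part of degree at most two of a polynomial. -/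
def lowPart (p : MvPolynomial (Fin n) ℝ) : MvPolynomial (Fin n) ℝ :=
  ∑ d ∈ Finset.range 3, MvPolynomial.homogeneousComponent d p

lemma coeff_lowPart (p : MvPolynomial (Fin n) ℝ) (m : Fin n →₀ ℕ) :
    (lowPart p).coeff m = if m.degree ≤ 2 then p.coeff m else 0 := by
  simp only [lowPart, MvPolynomial.coeff_sum, MvPolynomial.coeff_homogeneousComponent,
    Finset.sum_ite_eq, Finset.mem_range]
  exact if_congr (by omega) rfl rfl

lemma lowPart_mem (p : MvPolynomial (Fin n) ℝ) :
    lowPart p ∈ MvPolynomial.restrictTotalDegree (Fin n) ℝ 2 := by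
  rw [restrictTotalDegree_eq, MvPolynomial.mem_restrictSupport_iff]
  intro m hm
  rw [Finset.mem_coe, MvPolynomial.mem_support_iff, coeff_lowPart] at hm
  exact (ite_ne_right_iff.1 hm).1

lemma sub_lowPart_mem {k : ℕ} {p : MvPolynomial (Fin n) ℝ}
    (hp : p ∈ MvPolynomial.restrictTotalDegree (Fin n) ℝ k) :
    p - lowPart p ∈
      MvPolynomial.restrictSupport ℝ {m : Fin n →₀ ℕ | 3 ≤ m.degree ∧ m.degree ≤ k} := by
  rw [restrictTotalDegree_eq, MvPolynomial.mem_restrictSupport_iff] at hp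
  rw [MvPolynomial.mem_restrictSupport_iff]
  intro m hm
  rw [Finset.mem_coe, MvPolynomial.mem_support_iff, MvPolynomial.coeff_sub, coeff_lowPart] at hm
  split_ifs at hm with h
  · exact absurd (sub_self _) hm
  · refine ⟨by omega, hp (MvPolynomial.mem_support_iff.2 ?_)⟩
    simpa using hm

/-- The enriched space consists of the symmetric fields of degree at most `n + 1` whose divergence
has degree at most one: in such a field, the terms of degree at least three are divergence-free,
as their divergence has no term of degree less than two. -/
lemma mem_P2Star_iff (hn : 1 ≤ n) {τ : MatField n} : τ ∈ P2Star n ↔ τ ∈ symPoly n (n + 1) ∧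
    ∀ i, divergence τ i ∈ MvPolynomial.restrictTotalDegree (Fin n) ℝ 1 := by
  constructor
  · intro h
    obtain ⟨a, ha, b, hb, rfl⟩ := Submodule.mem_sup.1 h
    refine ⟨Submodule.add_mem _ ⟨ha.1, fun i j => restrictTotalDegree_mono (by omega) (ha.2 i j)⟩
      ⟨hb.1, fun i j => MvPolynomial.restrictSupport_mono ℝ (fun m hm => hm.2) (hb.2.1 i j)⟩,
      fun i => ?_⟩
    rw [← divL_apply, map_add, divL_apply, divL_apply, hb.2.2, add_zero]
    exact divergence_mem ha.2 i
  · rintro ⟨⟨hs, hd⟩, hdiv⟩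
    have hlow : τ.map lowPart ∈ symPoly n 2 :=
      ⟨hs.map _, fun i j => lowPart_mem _⟩
    have hhigh : ∀ i j, (τ - τ.map lowPart) i j ∈
        MvPolynomial.restrictSupport ℝ {m : Fin n →₀ ℕ | 3 ≤ m.degree ∧ m.degree ≤ n + 1} :=
      fun i j => sub_lowPart_mem (hd i j)
    rw [← sub_add_cancel τ (τ.map lowPart), add_comm]
    refine Submodule.add_mem_sup hlow ⟨hs.sub hlow.1, hhigh, funext fun i => ?_⟩
    have h1 : divergence (τ - τ.map lowPart) i ∈
        MvPolynomial.restrictTotalDegree (Fin n) ℝ 1 := by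
      rw [← divL_apply, map_sub]
      exact Submodule.sub_mem _ (hdiv i) (divergence_mem hlow.2 i)
    have h2 : divergence (τ - τ.map lowPart) i ∈
        MvPolynomial.restrictSupport ℝ {m : Fin n →₀ ℕ | 2 ≤ m.degree} := by
      refine Submodule.sum_mem _ fun j _ => pderiv_mem_restrictSupport (fun m hm => ?_) (hhigh i j)
      have : 3 ≤ (m + Finsupp.single j 1).degree := hm.1
      rw [map_add, Finsupp.degree_single] at this
      exact Nat.le_of_succ_le_succ this
    rw [restrictTotalDegree_eq, MvPolynomial.mem_restrictSupport_iff] at h1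
    rw [MvPolynomial.mem_restrictSupport_iff] at h2
    rw [Pi.zero_apply, ← MvPolynomial.support_eq_empty, Finset.eq_empty_iff_forall_notMem]
    intro m hm
    have ha : m.degree ≤ 1 := h1 hm
    have hb : 2 ≤ m.degree := h2 hm
    omega

/-- A polynomial has an antiderivative with respect to each variable. -/
lemma exists_pderiv_eq {k : ℕ} (i : Fin n) {p : MvPolynomial (Fin n) ℝ}
    (hp : p ∈ MvPolynomial.restrictTotalDegree (Fin n) ℝ k) :
    ∃ q ∈ MvPolynomial.restrictTotalDegree (Fin n) ℝ (k + 1), MvPolynomial.pderiv i q = p := by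
  have key : MvPolynomial.restrictTotalDegree (Fin n) ℝ k ≤
      (MvPolynomial.restrictTotalDegree (Fin n) ℝ (k + 1)).map
        (MvPolynomial.pderiv i).toLinearMap := by
    rw [restrictTotalDegree_eq, MvPolynomial.restrictSupport_eq_span, Submodule.span_le]
    rintro _ ⟨m, hm, rfl⟩
    refine ⟨MvPolynomial.monomial (m + Finsupp.single i 1) ((m i + 1 : ℝ)⁻¹), ?_, ?_⟩
    · refine (MvPolynomial.monomial_mem_restrictSupport ℝ).2 (Or.inl ?_)
      show (m + Finsupp.single i 1).degree ≤ k + 1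
      rw [map_add, Finsupp.degree_single]
      exact Nat.succ_le_succ hm
    · have : (m i + 1 : ℝ) ≠ 0 := by positivity
      simp [MvPolynomial.pderiv_monomial, this]
  obtain ⟨q, hq, rfl⟩ := key hp
  exact ⟨q, hq, rfl⟩

/-- The divergence is onto, already on diagonal fields. -/
lemma exists_divergence_eq {k : ℕ} {v : Fin n → MvPolynomial (Fin n) ℝ}
    (hv : ∀ i, v i ∈ MvPolynomial.restrictTotalDegree (Fin n) ℝ k) :
    ∃ τ ∈ symPoly n (k + 1), divergence τ = v := by
  choose q hq hqv using fun i => exists_pderiv_eq i (hv i)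
  refine ⟨Matrix.diagonal q, ⟨Matrix.isSymm_diagonal q, fun i j => ?_⟩, funext fun i => ?_⟩
  · by_cases h : i = j
    · subst h
      simpa using hq i
    · simp [Matrix.diagonal_apply_ne _ h]
  · rw [divergence, Finset.sum_eq_single i, Matrix.diagonal_apply_eq, hqv]
    · intro j _ hj
      rw [Matrix.diagonal_apply_ne _ hj.symm, map_zero]
    · simp

/-- A symmetric field is given by its components above and on the diagonal. -/
def symPolyEquiv (n k : ℕ) :
    symPoly n k ≃ₗ[ℝ] (SymPair n → MvPolynomial.restrictTotalDegree (Fin n) ℝ k) where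
  toFun τ p := ⟨τ.1 p.1.1 p.1.2, τ.2.2 _ _⟩
  map_add' _ _ := rfl
  map_smul' _ _ := rfl
  invFun f := ⟨Matrix.of fun i j => if h : i ≤ j then (f ⟨(i, j), h⟩).1 else
      (f ⟨(j, i), (not_le.1 h).le⟩).1, by
    refine ⟨Matrix.IsSymm.ext fun i j => ?_, fun i j => ?_⟩
    · rcases lt_trichotomy i j with h | rfl | h
      · simp [h.le, h.not_ge]
      · rfl
      · simp [h.le, h.not_ge]
    · simp only [Matrix.of_apply]
      split_ifs
      · exact (f _).2
      · exact (f _).2⟩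
  left_inv τ := by
    ext1
    ext1 i j
    by_cases h : i ≤ j
    · simp [h]
    · simpa [h] using τ.2.1.apply i j
  right_inv f := by
    funext p
    ext1
    simp [p.2]

instance (k : ℕ) : Module.Finite ℝ (symPoly n k) :=
  Module.Finite.equiv (symPolyEquiv n k).symm

lemma P2Star_le (hn : 1 ≤ n) : P2Star n ≤ symPoly n (n + 1) :=
  fun _ h => ((mem_P2Star_iff hn).1 h).1

lemma finite_P2Star (hn : 1 ≤ n) : Module.Finite ℝ (P2Star n) :=
  Submodule.finiteDimensional_of_le (P2Star_le hn)

lemma card_symPair (n : ℕ) : Fintype.card (SymPair n) = (n + 1).choose 2 := by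
  rw [← Fintype.card_congr (Sym2.sortEquiv (α := Fin n)), Sym2.card, Fintype.card_fin]

lemma finrank_symPoly (K : Affine.Simplex ℝ (E n) n) (k : ℕ) :
    Module.finrank ℝ (symPoly n k) = (n + 1).choose 2 * (n + k).choose k := by
  rw [(symPolyEquiv n k).finrank_eq, Module.finrank_pi_fintype]
  simp [finrank_restrictTotalDegree K, card_symPair]

/-- The families, indexed by `ι`, of polynomials of degree at most `k`. -/
def vecPoly (ι : Type*) (n k : ℕ) : Submodule ℝ (ι → MvPolynomial (Fin n) ℝ) :=
  Submodule.pi Set.univ fun _ => MvPolynomial.restrictTotalDegree (Fin n) ℝ k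

lemma mem_vecPoly {ι : Type*} {k : ℕ} {v : ι → MvPolynomial (Fin n) ℝ} :
    v ∈ vecPoly ι n k ↔ ∀ i, v i ∈ MvPolynomial.restrictTotalDegree (Fin n) ℝ k := by
  simp [vecPoly, Submodule.mem_pi]

/-- The elements of `vecPoly ι n k`, as families of elements of the space of polynomials of degree
at most `k`. -/
def vecPolyEquiv (ι : Type*) (n k : ℕ) :
    vecPoly ι n k ≃ₗ[ℝ] (ι → MvPolynomial.restrictTotalDegree (Fin n) ℝ k) where
  toFun v i := ⟨v.1 i, mem_vecPoly.1 v.2 i⟩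
  map_add' _ _ := rfl
  map_smul' _ _ := rfl
  invFun f := ⟨fun i => (f i).1, mem_vecPoly.2 fun i => (f i).2⟩
  left_inv _ := rfl
  right_inv _ := rfl

instance {ι : Type*} [Fintype ι] (k : ℕ) : Module.Finite ℝ (vecPoly ι n k) :=
  Module.Finite.equiv (vecPolyEquiv ι n k).symm

lemma finrank_vecPoly {ι : Type*} [Fintype ι] (K : Affine.Simplex ℝ (E n) n) (k : ℕ) :
    Module.finrank ℝ (vecPoly ι n k) = Fintype.card ι * (n + k).choose k := by
  rw [(vecPolyEquiv ι n k).finrank_eq, Module.finrank_pi_fintype]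
  simp [finrank_restrictTotalDegree K]

lemma finrank_map_add_finrank_inf_ker {V V' : Type*} [AddCommGroup V] [Module ℝ V]
    [AddCommGroup V'] [Module ℝ V'] (f : V →ₗ[ℝ] V') (S : Submodule ℝ V) [Module.Finite ℝ S] :
    Module.finrank ℝ (S.map f) + Module.finrank ℝ (S ⊓ LinearMap.ker f : Submodule ℝ V) =
      Module.finrank ℝ S := by
  rw [← (f.domRestrict S).finrank_range_add_finrank_ker, LinearMap.range_domRestrict,
    LinearMap.ker_domRestrict, ← Submodule.finrank_map_subtype_eq, Submodule.map_comap_subtype]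

lemma map_divL_symPoly (k : ℕ) : (symPoly n (k + 1)).map (divL n) = vecPoly (Fin n) n k := by
  apply le_antisymm
  · rintro _ ⟨τ, hτ, rfl⟩
    exact mem_vecPoly.2 (divergence_mem hτ.2)
  · intro v hv
    obtain ⟨τ, hτ, rfl⟩ := exists_divergence_eq (mem_vecPoly.1 hv)
    exact ⟨τ, hτ, rfl⟩

/-- `dim P₂*(K; 𝕊)`, by comparing the divergence on `P₂*(K; 𝕊)` and on all symmetric fields of degree at
most `n + 1`: the kernels are the same, the ranges are the vector fields of degree at most `1` and
at most `n`. The subtracted term is on the left, to avoid truncated subtraction. -/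
lemma finrank_P2Star (hn : 1 ≤ n) (K : Affine.Simplex ℝ (E n) n) :
    Module.finrank ℝ (P2Star n) + n * (n + n).choose n =
      (n + 1).choose 2 * (n + (n + 1)).choose (n + 1) + n * (n + 1) := by
  have := finite_P2Star hn
  have h1 := finrank_map_add_finrank_inf_ker (divL n) (symPoly n (n + 1))
  have h2 := finrank_map_add_finrank_inf_ker (divL n) (P2Star n)
  have h3 : P2Star n ⊓ LinearMap.ker (divL n) = symPoly n (n + 1) ⊓ LinearMap.ker (divL n) := by
    ext τ
    simp only [Submodule.mem_inf, LinearMap.mem_ker, divL_apply, mem_P2Star_iff hn]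
    refine and_congr_left fun h => and_iff_left fun i => ?_
    rw [h]
    exact Submodule.zero_mem _
  have h4 : (P2Star n).map (divL n) = vecPoly (Fin n) n 1 := by
    apply le_antisymm
    · rintro _ ⟨τ, hτ, rfl⟩
      exact mem_vecPoly.2 ((mem_P2Star_iff hn).1 hτ).2
    · intro v hv
      obtain ⟨τ, hτ, rfl⟩ := exists_divergence_eq (mem_vecPoly.1 hv)
      exact ⟨τ, Submodule.mem_sup_left hτ, rfl⟩
  rw [map_divL_symPoly, finrank_vecPoly K, Fintype.card_fin, finrank_symPoly K] at h1
  rw [h3, h4, finrank_vecPoly K, Fintype.card_fin, Nat.choose_one_right] at h2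
  omega

end Fields

/-! ### Fields with vanishing normal components on the boundary -/

section Bubbles

variable {n : ℕ} (K : Affine.Simplex ℝ (E n) n)

/-- The edges of an `n`-simplex, as pairs of vertices. -/
abbrev Edge (n : ℕ) := {e : Fin (n + 1) × Fin (n + 1) // e.1 < e.2}

lemma card_edge (n : ℕ) : Fintype.card (Edge n) = (n + 1).choose 2 := by
  have h1 := card_symPair (n + 1)
  have h2 : Fintype.card (SymPair (n + 1)) = Fintype.card (Edge n) + (n + 1) := by
    have e : Fintype.card {e : Fin (n + 1) × Fin (n + 1) // e.1 = e.2} = n + 1 := by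
      rw [Fintype.card_congr (show {e : Fin (n + 1) × Fin (n + 1) // e.1 = e.2} ≃ Fin (n + 1) from
        ⟨fun e => e.1.1, fun i => ⟨(i, i), rfl⟩, fun e => Subtype.ext (Prod.ext rfl e.2),
          fun _ => rfl⟩), Fintype.card_fin]
    rw [← Fintype.card_congr (Equiv.subtypeEquivRight fun e : Fin (n + 1) × Fin (n + 1) =>
        (le_iff_lt_or_eq (a := e.1) (b := e.2)).symm),
      Fintype.card_subtype_or_disjoint, e]
    rw [Pi.disjoint_iff]
    intro e
    rw [Prop.disjoint_iff]
    rintro ⟨h, h'⟩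
    exact h.ne h'
  have h3 : (n + 1 + 1).choose 2 = (n + 1) + (n + 1).choose 2 := by
    rw [Nat.choose_succ_succ' (n + 1) 1, Nat.choose_one_right]
  omega

lemma sum_sum_eq_two_mul_sum_edge {R : Type*} [CommRing R] (f : Fin (n + 1) → Fin (n + 1) → R)
    (hs : ∀ i j, f i j = f j i) (h0 : ∀ i, f i i = 0) :
    ∑ i, ∑ j, f i j = 2 * ∑ e : Edge n, f e.1.1 e.1.2 := by
  have h1 : ∑ e : Edge n, f e.1.1 e.1.2 =
      ∑ e : Fin (n + 1) × Fin (n + 1), if e.1 < e.2 then f e.1 e.2 else 0 := by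
    rw [← Finset.sum_filter, Finset.sum_subtype
      (p := fun e : Fin (n + 1) × Fin (n + 1) => e.1 < e.2) _ (by simp)]
  have h2 : ∑ e : Edge n, f e.1.1 e.1.2 =
      ∑ e : Fin (n + 1) × Fin (n + 1), if e.2 < e.1 then f e.1 e.2 else 0 := by
    rw [h1, ← (Equiv.prodComm _ _).sum_comp]
    refine Finset.sum_congr rfl fun e _ => ?_
    rw [Equiv.prodComm_apply, Prod.fst_swap, Prod.snd_swap, hs e.1 e.2]
  rw [two_mul]
  nth_rewrite 1 [h1]
  rw [h2, ← Finset.sum_add_distrib, ← Fintype.sum_prod_type']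
  refine Finset.sum_congr rfl fun e _ => ?_
  rcases lt_trichotomy e.1 e.2 with h | h | h
  · simp [h, h.not_gt]
  · simp [h, h0]
  · simp [h, h.not_gt]

lemma sum_baryGrad (k : Fin n) : ∑ i, baryGrad K i k = 0 := by
  have h := congrArg (MvPolynomial.pderiv k) (sum_bary K)
  rw [map_sum] at h
  simp only [pderiv_bary, MvPolynomial.pderiv_one, ← map_sum] at h
  exact (MvPolynomial.C_eq_zero).1 h

lemma sum_baryGrad_mul_vertex (k l : Fin n) :
    ∑ i, baryGrad K i k * K.points i l = if k = l then 1 else 0 := by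
  have h := congrArg (MvPolynomial.pderiv k) (sum_bary_mul_vertex K l)
  rw [map_sum] at h
  simp only [MvPolynomial.pderiv_mul, pderiv_bary, MvPolynomial.pderiv_C, mul_zero, add_zero,
    MvPolynomial.pderiv_X, ← map_mul, ← map_sum] at h
  refine MvPolynomial.C_injective (Fin n) ℝ (h.trans ?_)
  simp only [Pi.single_apply, eq_comm (a := l)]
  split_ifs <;> simp

/-- The coefficient of `t tᵀ`, for the edge vector `t = xᵢ - xⱼ`, in the expansion of a symmetric
matrix field in the basis formed by these matrices: it is `-∇λᵢᵀ τ ∇λⱼ`. -/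
def edgeCoeff (τ : MatField n) (i j : Fin (n + 1)) : MvPolynomial (Fin n) ℝ :=
  -∑ k, ∑ l, MvPolynomial.C (baryGrad K i k * baryGrad K j l) * τ k l

lemma edgeCoeff_comm {τ : MatField n} (hτ : τ.IsSymm) (i j : Fin (n + 1)) :
    edgeCoeff K τ i j = edgeCoeff K τ j i := by
  rw [edgeCoeff, edgeCoeff, Finset.sum_comm]
  congr 1
  refine Finset.sum_congr rfl fun k _ => Finset.sum_congr rfl fun l _ => ?_
  rw [hτ.apply k l, mul_comm (baryGrad K i l)]

lemma sum_edgeCoeff (τ : MatField n) (i : Fin (n + 1)) : ∑ j, edgeCoeff K τ i j = 0 := by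
  simp only [edgeCoeff, Finset.sum_neg_distrib]
  rw [neg_eq_zero, Finset.sum_comm]
  refine Finset.sum_eq_zero fun k _ => ?_
  rw [Finset.sum_comm]
  refine Finset.sum_eq_zero fun l _ => ?_
  rw [← Finset.sum_mul, ← map_sum, ← Finset.mul_sum, sum_baryGrad, mul_zero, map_zero, zero_mul]

lemma sum_edgeCoeff_mul_vertex (τ : MatField n) (k l : Fin n) :
    ∑ i, ∑ j, edgeCoeff K τ i j * MvPolynomial.C (K.points i k * K.points j l) = -τ k l := by
  have h : ∀ i j, edgeCoeff K τ i j * MvPolynomial.C (K.points i k * K.points j l) =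
      -∑ a, ∑ b, MvPolynomial.C (baryGrad K i a * K.points i k) *
        (MvPolynomial.C (baryGrad K j b * K.points j l) * τ a b) := by
    intro i j
    rw [edgeCoeff, neg_mul, Finset.sum_mul]
    congr 1
    refine Finset.sum_congr rfl fun a _ => ?_
    rw [Finset.sum_mul]
    refine Finset.sum_congr rfl fun b _ => ?_
    simp only [map_mul]
    ring
  simp only [h, Finset.sum_neg_distrib]
  congr 1
  have h2 : ∀ i, ∑ j, ∑ a, ∑ b, MvPolynomial.C (baryGrad K i a * K.points i k) *
        (MvPolynomial.C (baryGrad K j b * K.points j l) * τ a b) =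
      ∑ a, MvPolynomial.C (baryGrad K i a * K.points i k) * τ a l := by
    intro i
    rw [Finset.sum_comm]
    refine Finset.sum_congr rfl fun a _ => ?_
    rw [Finset.sum_comm]
    simp only [← Finset.mul_sum, ← Finset.sum_mul, ← map_sum, sum_baryGrad_mul_vertex]
    simp
  simp only [h2]
  rw [Finset.sum_comm]
  simp only [← Finset.sum_mul, ← map_sum, sum_baryGrad_mul_vertex]
  simp

/-- A symmetric matrix field is a combination of the matrices `t tᵀ`, for the edge vectors `t`. -/
lemma sum_edgeCoeff_mul_edge {τ : MatField n} (hτ : τ.IsSymm) (k l : Fin n) :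
    ∑ e : Edge n, MvPolynomial.C (edge K e.1.1 e.1.2 k * edge K e.1.1 e.1.2 l) *
      edgeCoeff K τ e.1.1 e.1.2 = τ k l := by
  have h := sum_sum_eq_two_mul_sum_edge (n := n)
    (fun i j => MvPolynomial.C (edge K i j k * edge K i j l) *
      edgeCoeff K τ i j) (fun i j => by
        rw [edgeCoeff_comm K hτ]
        congr 2
        simp only [edge]
        ring) (fun i => by simp [edge])
  have h2 : (2 : MvPolynomial (Fin n) ℝ) ≠ 0 := two_ne_zero
  refine mul_left_cancel₀ h2 (h.symm.trans ?_)
  -- expanding `t tᵀ`, the square terms drop out since `∑ⱼ ∇λⱼ = 0`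
  have e : ∀ i j, MvPolynomial.C (edge K i j k * edge K i j l) * edgeCoeff K τ i j =
      MvPolynomial.C (K.points i k * K.points i l) * edgeCoeff K τ i j +
      MvPolynomial.C (K.points j k * K.points j l) * edgeCoeff K τ j i -
      edgeCoeff K τ i j * MvPolynomial.C (K.points i k * K.points j l) -
      edgeCoeff K τ j i * MvPolynomial.C (K.points j k * K.points i l) := by
    intro i j
    rw [edgeCoeff_comm K hτ j i]
    simp only [edge, map_sub, map_mul]
    ring
  simp only [e, Finset.sum_sub_distrib, Finset.sum_add_distrib]
  have z1 : ∑ i, ∑ j, MvPolynomial.C (K.points i k * K.points i l) * edgeCoeff K τ i j = 0 := by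
    refine Finset.sum_eq_zero fun i _ => ?_
    rw [← Finset.mul_sum, sum_edgeCoeff, mul_zero]
  have z2 : ∑ i, ∑ j, MvPolynomial.C (K.points j k * K.points j l) * edgeCoeff K τ j i = 0 := by
    rw [Finset.sum_comm]
    exact z1
  have z3 : ∑ i, ∑ j, edgeCoeff K τ j i * MvPolynomial.C (K.points j k * K.points i l) =
      -τ k l := by
    rw [Finset.sum_comm]
    exact sum_edgeCoeff_mul_vertex K τ k l
  rw [z1, z2, z3, sum_edgeCoeff_mul_vertex]
  ring

/-- The field `∑ λᵢ λⱼ pᵢⱼ t tᵀ`, the sum being over the edges `xᵢ xⱼ`, with `t = xᵢ - xⱼ`. -/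
def bubble : (Edge n → MvPolynomial (Fin n) ℝ) →ₗ[ℝ] MatField n where
  toFun p := Matrix.of fun k l => ∑ e : Edge n,
    MvPolynomial.C (edge K e.1.1 e.1.2 k * edge K e.1.1 e.1.2 l) *
      (bary K e.1.1 * bary K e.1.2 * p e)
  map_add' p q := by
    ext1 k l
    simp [mul_add, Finset.sum_add_distrib]
  map_smul' c p := by
    ext1 k l
    simp [Finset.smul_sum]

lemma bubble_apply (p : Edge n → MvPolynomial (Fin n) ℝ) (k l : Fin n) :
    bubble K p k l = ∑ e : Edge n,
      MvPolynomial.C (edge K e.1.1 e.1.2 k * edge K e.1.1 e.1.2 l) *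
        (bary K e.1.1 * bary K e.1.2 * p e) := rfl

lemma bubble_mem {k : ℕ} {p : Edge n → MvPolynomial (Fin n) ℝ}
    (hp : ∀ e, p e ∈ MvPolynomial.restrictTotalDegree (Fin n) ℝ k) :
    bubble K p ∈ symPoly n (k + 2) := by
  refine ⟨Matrix.IsSymm.ext fun k l => ?_, fun a b => ?_⟩
  · rw [bubble_apply, bubble_apply]
    exact Finset.sum_congr rfl fun e _ => by rw [mul_comm (edge K e.1.1 e.1.2 l)]
  · refine Submodule.sum_mem _ fun e _ => C_mul_mem_restrictTotalDegree _ ?_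
    have := mul_mem_restrictTotalDegree (mul_mem_restrictTotalDegree (bary_mem K e.1.1)
      (bary_mem K e.1.2)) (hp e)
    exact restrictTotalDegree_mono (by omega) this

/-- The coefficients `λᵢ λⱼ pᵢⱼ` are recovered as the coefficients of the matrices `t tᵀ`. -/
lemma bubble_injective : Function.Injective (bubble K) := by
  rw [← LinearMap.ker_eq_bot, LinearMap.ker_eq_bot']
  intro p hp
  funext e
  have h : edgeCoeff K (bubble K p) e.1.1 e.1.2 = bary K e.1.1 * bary K e.1.2 * p e := by
    have h1 : edgeCoeff K (bubble K p) e.1.1 e.1.2 = -∑ f : Edge n,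
        MvPolynomial.C ((∑ k, baryGrad K e.1.1 k * edge K f.1.1 f.1.2 k) *
          ∑ l, baryGrad K e.1.2 l * edge K f.1.1 f.1.2 l) *
            (bary K f.1.1 * bary K f.1.2 * p f) := by
      rw [edgeCoeff]
      congr 1
      simp only [bubble_apply, Finset.mul_sum, Finset.sum_mul, map_sum]
      rw [Finset.sum_congr rfl fun k _ => Finset.sum_comm, Finset.sum_comm]
      refine Finset.sum_congr rfl fun f _ => ?_
      rw [Finset.sum_comm]
      refine Finset.sum_congr rfl fun k _ => Finset.sum_congr rfl fun l _ => ?_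
      simp only [map_mul]
      ring
    rw [h1, Finset.sum_eq_single e]
    · have := e.2.ne
      simp [sum_baryGrad_mul_edge, this, this.symm]
    · intro f _ hf
      have h2 : (∑ k, baryGrad K e.1.1 k * edge K f.1.1 f.1.2 k) *
          ∑ l, baryGrad K e.1.2 l * edge K f.1.1 f.1.2 l = 0 := by
        rw [sum_baryGrad_mul_edge, sum_baryGrad_mul_edge]
        obtain ⟨⟨i, j⟩, hij⟩ := e
        obtain ⟨⟨a, b⟩, hab⟩ := f
        simp only at hij hab ⊢
        have hne : ¬ (a = i ∧ b = j) := fun h => hf (by simp [h.1, h.2])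
        split_ifs <;> simp <;> grind
      rw [h2, map_zero, zero_mul]
    · simp
  rw [hp] at h
  have h0 : edgeCoeff K 0 e.1.1 e.1.2 = 0 := by simp [edgeCoeff]
  rw [h0] at h
  simpa [bary_ne_zero] using h.symm

lemma mem_normalSpace_iff {ℓ : ℕ} (s : Face n ℓ) (v : E n) :
    v ∈ normalSpace K s ↔ ∀ i ∈ s.1, ∀ j ∈ s.1, ∑ k, edge K i j k * v k = 0 := by
  have hin : ∀ i j, inner ℝ (K.points i - K.points j) v = ∑ k, edge K i j k * v k := fun i j => by
    rw [PiLp.inner_apply]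
    exact Finset.sum_congr rfl fun k _ => by simp [edge, mul_comm]
  have hr : tangentSpace K s =
      Submodule.span ℝ ((K.points '' (s.1 : Set (Fin (n + 1)))) -ᵥ (K.points '' s.1)) := by
    rw [tangentSpace, Affine.Simplex.range_face_points, vectorSpan]
  rw [normalSpace, hr, Submodule.mem_orthogonal]
  constructor
  · intro h i hi j hj
    rw [← hin]
    exact h _ (Submodule.subset_span ⟨_, ⟨i, hi, rfl⟩, _, ⟨j, hj, rfl⟩, rfl⟩)
  · intro h u hu
    induction hu using Submodule.span_induction with
    | mem u hu =>
      obtain ⟨_, ⟨i, hi, rfl⟩, _, ⟨j, hj, rfl⟩, rfl⟩ := hu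
      exact (hin i j).trans (h i hi j hj)
    | zero => exact inner_zero_left v
    | add x y _ _ hx hy => rw [inner_add_left, hx, hy, add_zero]
    | smul a x _ hx => rw [inner_smul_left, hx, mul_zero]

lemma baryGrad_mem_normalSpace {ℓ : ℕ} (s : Face n ℓ) {i : Fin (n + 1)} (hi : i ∉ s.1) :
    WithLp.toLp 2 (baryGrad K i) ∈ normalSpace K s := by
  rw [mem_normalSpace_iff]
  intro a ha b hb
  have hia : i ≠ a := fun h => hi (h ▸ ha)
  have hib : i ≠ b := fun h => hi (h ▸ hb)
  simpa [hia, hib, mul_comm] using sum_baryGrad_mul_edge K i a b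

/-- The fields with vanishing normal components on the boundary: `τ ν = 0` on all facets. -/
def NormalFree (τ : MatField n) : Prop :=
  ∀ s : Face n (n - 1), ∀ x ∈ faceSet K s, ∀ ν ∈ normalSpace K s, (evalAt τ x).mulVec ν.ofLp = 0

lemma bubble_normalFree (p : Edge n → MvPolynomial (Fin n) ℝ) :
    NormalFree K (bubble K p) := by
  intro s x hx ν hν
  funext k
  rw [mem_normalSpace_iff] at hν
  simp only [Matrix.mulVec, dotProduct, evalAt, Matrix.map_apply, bubble_apply, map_sum, map_mul,
    MvPolynomial.eval_C, Finset.sum_mul, Pi.zero_apply, eval_bary]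
  rw [Finset.sum_comm]
  refine Finset.sum_eq_zero fun e _ => ?_
  have hx0 := ((mem_faceSet_iff K s x).1 hx).2
  by_cases h1 : e.1.1 ∈ s.1
  · by_cases h2 : e.1.2 ∈ s.1
    · have h := hν _ h1 _ h2
      calc _ = edge K e.1.1 e.1.2 k * ((vertexBasis K).coord e.1.1 x *
            (vertexBasis K).coord e.1.2 x * MvPolynomial.eval x.ofLp (p e)) *
            ∑ l, edge K e.1.1 e.1.2 l * ν l := by
              rw [Finset.mul_sum]
              exact Finset.sum_congr rfl fun l _ => by ring
        _ = 0 := by rw [h, mul_zero]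
    · simp [hx0 _ h2]
  · simp [hx0 _ h1]

/-- The symmetric fields with `τ ν = 0` on the boundary are the fields `∑ λᵢ λⱼ pᵢⱼ t tᵀ`: the
coefficient `-∇λᵢᵀ τ ∇λⱼ` of `t tᵀ` vanishes on the facets `λᵢ = 0` and `λⱼ = 0`. -/
lemma exists_eq_bubble (hn : 1 ≤ n) {k : ℕ} {τ : MatField n} (hτ : τ ∈ symPoly n k)
    (h : NormalFree K τ) :
    ∃ p : Edge n → MvPolynomial (Fin n) ℝ,
      (∀ e, p e ∈ MvPolynomial.restrictTotalDegree (Fin n) ℝ (k - 2)) ∧ τ = bubble K p := by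
  have hvan : ∀ (i j : Fin (n + 1)) (s : Face n (n - 1)), j ∉ s.1 → ∀ x ∈ faceSet K s,
      MvPolynomial.eval x.ofLp (edgeCoeff K τ i j) = 0 := by
    intro i j s hj x hx
    have h1 := h s x hx _ (baryGrad_mem_normalSpace K s hj)
    simp only [edgeCoeff, map_neg, map_sum, map_mul, MvPolynomial.eval_C, neg_eq_zero]
    refine Finset.sum_eq_zero fun a _ => ?_
    have h2 := congrFun h1 a
    simp only [Matrix.mulVec, dotProduct, evalAt, Matrix.map_apply, Pi.zero_apply] at h2
    calc _ = baryGrad K i a * ∑ b, MvPolynomial.eval x.ofLp (τ a b) * baryGrad K j b := by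
          rw [Finset.mul_sum]
          exact Finset.sum_congr rfl fun b _ => by ring
      _ = 0 := by rw [h2, mul_zero]
  have hc : ∀ e : Edge n, ∃ q ∈ MvPolynomial.restrictTotalDegree (Fin n) ℝ (k - 2),
      edgeCoeff K τ e.1.1 e.1.2 = bary K e.1.1 * bary K e.1.2 * q := by
    intro e
    refine exists_eq_bary_mul_bary_mul K hn e.2.ne (k := k) ?_ fun s hs x hx => ?_
    · exact Submodule.neg_mem _ (Submodule.sum_mem _ fun a _ => Submodule.sum_mem _ fun b _ =>
        C_mul_mem_restrictTotalDegree _ (hτ.2 a b))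
    · rcases hs with hs | hs
      · rw [edgeCoeff_comm K hτ.1]
        exact hvan _ _ s hs x hx
      · exact hvan _ _ s hs x hx
  choose p hp hpe using hc
  refine ⟨p, hp, ?_⟩
  ext1 a b
  rw [bubble_apply, ← sum_edgeCoeff_mul_edge K hτ.1 a b]
  exact Finset.sum_congr rfl fun e _ => by rw [hpe]

/-- The derivative, along an edge, of the component of `v` along the same edge. -/
def edgeStrain (v : Fin n → MvPolynomial (Fin n) ℝ) (e : Edge n) : MvPolynomial (Fin n) ℝ :=
  dirDeriv (edge K e.1.1 e.1.2) (∑ k, MvPolynomial.C (edge K e.1.1 e.1.2 k) * v k)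

lemma edgeStrain_eq (v : Fin n → MvPolynomial (Fin n) ℝ) (e : Edge n) :
    edgeStrain K v e = ∑ k, ∑ l, MvPolynomial.C (edge K e.1.1 e.1.2 k * edge K e.1.1 e.1.2 l) *
      MvPolynomial.pderiv l (v k) := by
  simp only [edgeStrain, dirDeriv, map_sum, MvPolynomial.pderiv_C_mul, Finset.mul_sum, map_mul]
  rw [Finset.sum_comm]
  exact Finset.sum_congr rfl fun k _ => Finset.sum_congr rfl fun l _ => by ring

lemma edgeStrain_mem {k : ℕ} {v : Fin n → MvPolynomial (Fin n) ℝ}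
    (hv : ∀ i, v i ∈ MvPolynomial.restrictTotalDegree (Fin n) ℝ (k + 1)) (e : Edge n) :
    edgeStrain K v e ∈ MvPolynomial.restrictTotalDegree (Fin n) ℝ k :=
  dirDeriv_mem _ (Submodule.sum_mem _ fun i _ => C_mul_mem_restrictTotalDegree _ (hv i))

lemma sum_bubble_mul_pderiv (p : Edge n → MvPolynomial (Fin n) ℝ)
    (v : Fin n → MvPolynomial (Fin n) ℝ) :
    ∑ k, ∑ l, bubble K p k l * MvPolynomial.pderiv l (v k) =
      ∑ e : Edge n, bary K e.1.1 * bary K e.1.2 * p e * edgeStrain K v e := by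
  simp only [bubble_apply, edgeStrain_eq, Finset.sum_mul, Finset.mul_sum]
  rw [Finset.sum_congr rfl fun k _ => Finset.sum_comm, Finset.sum_comm]
  refine Finset.sum_congr rfl fun e _ => Finset.sum_congr rfl fun k _ =>
    Finset.sum_congr rfl fun l _ => by ring

/-- Integration by parts, for the fields with vanishing normal components on the boundary. -/
lemma polyIntegral_divergence_bubble (p : Edge n → MvPolynomial (Fin n) ℝ)
    (v : Fin n → MvPolynomial (Fin n) ℝ) :
    polyIntegral K (∑ k, divergence (bubble K p) k * v k) =
      -polyIntegral K (∑ e : Edge n, bary K e.1.1 * bary K e.1.2 * p e * edgeStrain K v e) := by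
  have h : ∑ k, divergence (bubble K p) k * v k = ∑ e : Edge n,
      (dirDeriv (edge K e.1.1 e.1.2) (bary K e.1.1 * bary K e.1.2 * (p e *
        ∑ k, MvPolynomial.C (edge K e.1.1 e.1.2 k) * v k)) -
      bary K e.1.1 * bary K e.1.2 * p e * edgeStrain K v e) := by
    have h1 : ∀ e : Edge n, dirDeriv (edge K e.1.1 e.1.2) (bary K e.1.1 * bary K e.1.2 * (p e *
        ∑ k, MvPolynomial.C (edge K e.1.1 e.1.2 k) * v k)) -
        bary K e.1.1 * bary K e.1.2 * p e * edgeStrain K v e =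
        dirDeriv (edge K e.1.1 e.1.2) (bary K e.1.1 * bary K e.1.2 * p e) *
          ∑ k, MvPolynomial.C (edge K e.1.1 e.1.2 k) * v k := fun e => by
      rw [← mul_assoc, dirDeriv_mul, edgeStrain]
      ring
    rw [Finset.sum_congr rfl fun e _ => h1 e]
    simp only [dirDeriv, Finset.sum_mul, Finset.mul_sum]
    simp only [divergence, bubble_apply, map_sum, MvPolynomial.pderiv_C_mul, Finset.sum_mul]
    rw [Finset.sum_congr rfl fun k _ => Finset.sum_comm, Finset.sum_comm]
    refine Finset.sum_congr rfl fun e _ => ?_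
    refine Finset.sum_congr rfl fun k _ => Finset.sum_congr rfl fun l _ => ?_
    rw [map_mul]
    ring
  rw [h, map_sum, map_sum, ← Finset.sum_neg_distrib]
  refine Finset.sum_congr rfl fun e _ => ?_
  rw [map_sub, polyIntegral_dirDeriv_edge K e.2.ne, zero_sub]

/-- A vector field whose edge strains vanish has vanishing symmetric gradient. -/
lemma strain_eq_zero {v : Fin n → MvPolynomial (Fin n) ℝ} (h : ∀ e, edgeStrain K v e = 0)
    (i j : Fin n) : MvPolynomial.pderiv j (v i) + MvPolynomial.pderiv i (v j) = 0 := by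
  -- pair the gradient of `v` with a symmetric matrix, expanded along the edges
  set A : MatField n := Matrix.single i j 1 + Matrix.single j i 1 with hA
  have hAs : A.IsSymm := by
    rw [hA, Matrix.IsSymm, Matrix.transpose_add, Matrix.transpose_single, Matrix.transpose_single,
      add_comm]
  have h1 : ∑ k, ∑ l, A k l * MvPolynomial.pderiv l (v k) = 0 := by
    simp only [← sum_edgeCoeff_mul_edge K hAs, Finset.sum_mul]
    rw [Finset.sum_congr rfl fun k _ => Finset.sum_comm, Finset.sum_comm]
    refine Finset.sum_eq_zero fun e _ => ?_
    have := h e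
    rw [edgeStrain_eq] at this
    calc _ = edgeCoeff K A e.1.1 e.1.2 * ∑ k, ∑ l, MvPolynomial.C (edge K e.1.1 e.1.2 k *
          edge K e.1.1 e.1.2 l) * MvPolynomial.pderiv l (v k) := by
          simp only [Finset.mul_sum]
          exact Finset.sum_congr rfl fun k _ => Finset.sum_congr rfl fun l _ => by ring
      _ = 0 := by rw [this, mul_zero]
  simpa [hA, Matrix.single_apply, add_mul, Finset.sum_add_distrib, ite_and] using h1

end Bubbles

/-! ### The dimension of `M₂(K)` -/

section DimensionM2

variable {n : ℕ}

/-- Twice the symmetric gradient of a vector field. -/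
def strain (n : ℕ) : (Fin n → MvPolynomial (Fin n) ℝ) →ₗ[ℝ] MatField n where
  toFun v := Matrix.of fun i j => MvPolynomial.pderiv j (v i) + MvPolynomial.pderiv i (v j)
  map_add' u v := by
    ext1 i j
    simp [add_add_add_comm]
  map_smul' c v := by
    ext1 i j
    simp

lemma strain_apply (v : Fin n → MvPolynomial (Fin n) ℝ) (i j : Fin n) :
    strain n v i j = MvPolynomial.pderiv j (v i) + MvPolynomial.pderiv i (v j) := rfl

/-- A polynomial whose second derivatives vanish has degree at most one. -/
lemma mem_restrictTotalDegree_one {p : MvPolynomial (Fin n) ℝ}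
    (h : ∀ i j, MvPolynomial.pderiv i (MvPolynomial.pderiv j p) = 0) :
    p ∈ MvPolynomial.restrictTotalDegree (Fin n) ℝ 1 := by
  rw [restrictTotalDegree_eq, MvPolynomial.mem_restrictSupport_iff]
  intro m hm
  rw [Finset.mem_coe, MvPolynomial.mem_support_iff] at hm
  by_contra hdeg
  have hdeg : 1 < m.degree := by
    simpa using hdeg
  have hex : ∀ m' : Fin n →₀ ℕ, 1 ≤ m'.degree → ∃ j, ∃ m'', m' = m'' + Finsupp.single j 1 := by
    intro m' hm'
    have h0 : m' ≠ 0 := by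
      rintro rfl
      simp at hm'
    obtain ⟨j, hj⟩ := Finsupp.ne_iff.1 h0
    refine ⟨j, m' - Finsupp.single j 1, (tsub_add_cancel_of_le ?_).symm⟩
    exact Finsupp.single_le_iff.2 (Nat.one_le_iff_ne_zero.2 hj)
  obtain ⟨j, m', rfl⟩ := hex m (by omega)
  rw [map_add, Finsupp.degree_single] at hdeg
  obtain ⟨i, m'', rfl⟩ := hex m' (by omega)
  have h1 := congrArg (MvPolynomial.coeff m'') (h i j)
  rw [MvPolynomial.coeff_pderiv, MvPolynomial.coeff_pderiv, MvPolynomial.coeff_zero] at h1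
  rcases mul_eq_zero.1 h1 with h2 | h2
  · rcases mul_eq_zero.1 h2 with h3 | h3
    · exact hm h3
    · exact absurd h3 (by positivity)
  · exact absurd h2 (by positivity)

/-- Vector fields with vanishing symmetric gradient are affine: `∂ₖ ∂ⱼ vᵢ` is symmetric in `j, k` and
antisymmetric in `i, j`. -/
lemma mem_vecPoly_one_of_strain_eq_zero {v : Fin n → MvPolynomial (Fin n) ℝ}
    (h : strain n v = 0) : v ∈ vecPoly (Fin n) n 1 := by
  refine mem_vecPoly.2 fun i => mem_restrictTotalDegree_one fun k j => ?_
  have hanti : ∀ i j, MvPolynomial.pderiv j (v i) = -MvPolynomial.pderiv i (v j) := fun i j =>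
    eq_neg_of_add_eq_zero_left (by rw [← strain_apply, h]; rfl)
  have hcomm : ∀ a b (p : MvPolynomial (Fin n) ℝ), MvPolynomial.pderiv a (MvPolynomial.pderiv b p) =
      MvPolynomial.pderiv b (MvPolynomial.pderiv a p) := by
    intro a b p
    ext m
    rw [MvPolynomial.coeff_pderiv, MvPolynomial.coeff_pderiv, MvPolynomial.coeff_pderiv,
      MvPolynomial.coeff_pderiv, add_right_comm]
    by_cases hab : a = b
    · rw [hab]
    · simp only [Finsupp.add_apply, Finsupp.single_eq_of_ne hab,
        Finsupp.single_eq_of_ne (Ne.symm hab), add_zero]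
      ring
  have e : MvPolynomial.pderiv k (MvPolynomial.pderiv j (v i)) =
      -MvPolynomial.pderiv k (MvPolynomial.pderiv j (v i)) := by
    calc MvPolynomial.pderiv k (MvPolynomial.pderiv j (v i))
        = -MvPolynomial.pderiv i (MvPolynomial.pderiv k (v j)) := by
          rw [hanti i j, map_neg, hcomm]
      _ = MvPolynomial.pderiv j (MvPolynomial.pderiv i (v k)) := by
          rw [hanti j k, map_neg, neg_neg, hcomm]
      _ = -MvPolynomial.pderiv k (MvPolynomial.pderiv j (v i)) := by
          rw [hanti k i, map_neg, hcomm]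
  exact self_eq_neg.1 e

lemma map_strain_vecPoly_one : (vecPoly (Fin n) n 1).map (strain n) = symPoly n 0 := by
  apply le_antisymm
  · rintro _ ⟨v, hv, rfl⟩
    refine ⟨Matrix.IsSymm.ext fun i j => ?_, fun i j => ?_⟩
    · rw [strain_apply, strain_apply, add_comm]
    · exact Submodule.add_mem _ (pderiv_mem j (mem_vecPoly.1 hv i))
        (pderiv_mem i (mem_vecPoly.1 hv j))
  · intro A hA
    have hc : ∀ i j, ∃ c : ℝ, A i j = MvPolynomial.C c := fun i j => by
      have := (MvPolynomial.mem_restrictTotalDegree _ _ _).1 (hA.2 i j)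
      exact ⟨_, MvPolynomial.totalDegree_eq_zero_iff_eq_C.1 (Nat.le_zero.1 this)⟩
    choose c hc using hc
    have hcs : ∀ i j, c i j = c j i := fun i j =>
      MvPolynomial.C_injective (Fin n) ℝ (by rw [← hc, ← hc, hA.1.apply])
    refine ⟨fun i => ∑ j, MvPolynomial.C (c i j / 2) * MvPolynomial.X j,
      mem_vecPoly.2 fun i => Submodule.sum_mem _ fun j _ => C_mul_mem_restrictTotalDegree _ ?_, ?_⟩
    · rw [MvPolynomial.mem_restrictTotalDegree, MvPolynomial.totalDegree_X]
    · ext1 i j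
      rw [strain_apply]
      simp only [map_sum, MvPolynomial.pderiv_C_mul, MvPolynomial.pderiv_X, Pi.single_apply]
      simp only [mul_ite, mul_one, mul_zero, Finset.sum_ite_eq', Finset.mem_univ, if_true]
      rw [hcs j i, ← map_add, add_halves, hc]

/-- The space of rigid motions has dimension `n (n + 1) / 2`: it is the kernel of the symmetric
gradient, which maps the affine fields onto the constant symmetric matrices. -/
lemma finrank_ker_strain (hn : 1 ≤ n) (K : Affine.Simplex ℝ (E n) n) :
    Module.finrank ℝ (vecPoly (Fin n) n n ⊓ LinearMap.ker (strain n) :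
      Submodule ℝ (Fin n → MvPolynomial (Fin n) ℝ)) = (n + 1).choose 2 := by
  have h1 : vecPoly (Fin n) n n ⊓ LinearMap.ker (strain n) =
      vecPoly (Fin n) n 1 ⊓ LinearMap.ker (strain n) := by
    ext v
    simp only [Submodule.mem_inf, LinearMap.mem_ker]
    refine and_congr_left fun h => ?_
    have h2 := mem_vecPoly_one_of_strain_eq_zero h
    exact iff_of_true (mem_vecPoly.2 fun i =>
      restrictTotalDegree_mono hn (mem_vecPoly.1 h2 i)) h2
  have h2 := finrank_map_add_finrank_inf_ker (strain n) (vecPoly (Fin n) n 1)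
  rw [map_strain_vecPoly_one, finrank_symPoly K, finrank_vecPoly K, Fintype.card_fin,
    Nat.choose_zero_right, Nat.choose_one_right, mul_one] at h2
  rw [h1]
  have h3 := Nat.add_one_mul_choose_eq n 1
  rw [Nat.choose_one_right] at h3
  nlinarith

variable (K : Affine.Simplex ℝ (E n) n)

/-- The fields of degree at most `k + 2` which are combinations `∑ λᵢ λⱼ pᵢⱼ t tᵀ` over the edges. -/
def bubbleSpace (k : ℕ) : Submodule ℝ (MatField n) := (vecPoly (Edge n) n k).map (bubble K)

instance (k : ℕ) : Module.Finite ℝ (bubbleSpace K k) :=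
  inferInstanceAs (Module.Finite ℝ ((vecPoly (Edge n) n k).map (bubble K)))

lemma finrank_bubbleSpace (k : ℕ) :
    Module.finrank ℝ (bubbleSpace K k) = (n + 1).choose 2 * (n + k).choose k := by
  rw [bubbleSpace, LinearEquiv.finrank_eq
    (Submodule.equivMapOfInjective _ (bubble_injective K) _).symm,
    finrank_vecPoly K, card_edge]

lemma M2_eq (hn : 1 ≤ n) : M2 K = bubbleSpace K (n - 1) ⊓ LinearMap.ker (divL n) := by
  ext τ
  constructor
  · rintro ⟨h1, h2, h3⟩
    refine ⟨?_, h2⟩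
    obtain ⟨p, hp, rfl⟩ := exists_eq_bubble K hn (P2Star_le hn h1) h3
    exact ⟨p, mem_vecPoly.2 hp, rfl⟩
  · rintro ⟨⟨p, hp, rfl⟩, h2⟩
    have h2 : divergence (bubble K p) = 0 := h2
    refine ⟨(mem_P2Star_iff hn).2 ⟨?_, fun i => ?_⟩, h2, bubble_normalFree K p⟩
    · have := bubble_mem K (mem_vecPoly.1 hp)
      rwa [show n - 1 + 2 = n + 1 by omega] at this
    · rw [h2]
      exact Submodule.zero_mem _

/-- The `L²` inner product over `K` of vector fields. -/
def vecForm (k : ℕ) : LinearMap.BilinForm ℝ (vecPoly (Fin n) n k) :=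
  LinearMap.mk₂ ℝ (fun u v => polyIntegral K (∑ i, u.1 i * v.1 i))
    (fun u u' v => by simp [add_mul, Finset.sum_add_distrib])
    (fun c u v => by simp [← Finset.smul_sum])
    (fun u v v' => by simp [mul_add, Finset.sum_add_distrib])
    (fun c u v => by simp [← Finset.smul_sum])

lemma eq_zero_of_polyIntegral_sum_sq {ι : Type*} [Fintype ι] {v : ι → MvPolynomial (Fin n) ℝ}
    (h : polyIntegral K (∑ i, v i * v i) = 0) : v = 0 := by
  have h1 := eq_zero_of_polyIntegral K (fun x _ => by
    rw [map_sum]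
    exact Finset.sum_nonneg fun i _ => by rw [map_mul]; exact mul_self_nonneg _) h
  funext i
  refine MvPolynomial.funext fun x => ?_
  have h2 := congrArg (MvPolynomial.eval x) h1
  rw [map_sum, map_zero, Finset.sum_eq_zero_iff_of_nonneg
    (fun i _ => by rw [map_mul]; exact mul_self_nonneg _)] at h2
  simpa using h2 i (Finset.mem_univ i)

lemma vecForm_nondegenerate (k : ℕ) : (vecForm K k).Nondegenerate := by
  constructor
  · intro u hu
    exact Subtype.ext (eq_zero_of_polyIntegral_sum_sq K (hu u))
  · intro u hu
    exact Subtype.ext (eq_zero_of_polyIntegral_sum_sq K (hu u))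

/-- A vector field is orthogonal to all divergences of fields in the bubble space if and only if its
symmetric gradient vanishes. -/
lemma orthogonal_divergence_iff (hn : 1 ≤ n) {v : Fin n → MvPolynomial (Fin n) ℝ}
    (hv : v ∈ vecPoly (Fin n) n n) :
    (∀ τ ∈ bubbleSpace K (n - 1), polyIntegral K (∑ i, divergence τ i * v i) = 0) ↔
      strain n v = 0 := by
  constructor
  · intro h
    have hstrain : ∀ e, edgeStrain K v e = 0 := by
      intro e
      -- test against the field whose only coefficient is `∂ₜ(t · v)`, on the edge `e`
      have hp : Pi.single e (edgeStrain K v e) ∈ vecPoly (Edge n) n (n - 1) := by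
        refine mem_vecPoly.2 fun f => ?_
        by_cases hfe : f = e
        · subst hfe
          rw [Pi.single_eq_same]
          refine edgeStrain_mem K (fun i => ?_) f
          rw [Nat.sub_add_cancel hn]
          exact mem_vecPoly.1 hv i
        · rw [Pi.single_eq_of_ne hfe]
          exact Submodule.zero_mem _
      have h1 := h _ ⟨_, hp, rfl⟩
      rw [polyIntegral_divergence_bubble, neg_eq_zero, Finset.sum_eq_single e (fun f _ hf => by
        rw [Pi.single_eq_of_ne hf]; ring) (by simp), Pi.single_eq_same] at h1
      have h2 := eq_zero_of_polyIntegral K (fun x hx => by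
        have := (mem_closedInterior_iff K x).1 hx
        rw [mul_assoc, map_mul, map_mul, map_mul, eval_bary, eval_bary]
        exact mul_nonneg (mul_nonneg (this _) (this _)) (mul_self_nonneg _)) h1
      simpa [bary_ne_zero] using h2
    ext1 i j
    exact strain_eq_zero K hstrain i j
  · rintro h _ ⟨p, -, rfl⟩
    rw [polyIntegral_divergence_bubble, Finset.sum_eq_zero, map_zero, neg_zero]
    intro e _
    have : edgeStrain K v e = 0 := by
      have h2 : (2 : MvPolynomial (Fin n) ℝ) * edgeStrain K v e = 0 := by
        rw [edgeStrain_eq, two_mul]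
        nth_rewrite 2 [Finset.sum_comm]
        simp only [← Finset.sum_add_distrib]
        refine Finset.sum_eq_zero fun k _ => Finset.sum_eq_zero fun l _ => ?_
        rw [mul_comm (edge K e.1.1 e.1.2 l), ← mul_add, ← strain_apply, h]
        simp
      exact (mul_eq_zero.1 h2).resolve_left two_ne_zero
    rw [this, mul_zero]

/-- `dim M₂(K)`: the divergences of the bubble fields are the orthogonal complement of the rigid
motions. -/
lemma finrank_M2 (hn : 1 ≤ n) :
    Module.finrank ℝ (M2 K) + n * (n + n).choose n =
      (n + 1).choose 2 * (n + (n - 1)).choose (n - 1) + (n + 1).choose 2 := by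
  have h1 := finrank_map_add_finrank_inf_ker (divL n) (bubbleSpace K (n - 1))
  rw [← M2_eq K hn, finrank_bubbleSpace] at h1
  set U := (bubbleSpace K (n - 1)).map (divL n) with hU
  have hUV : U ≤ vecPoly (Fin n) n n := by
    rintro _ ⟨_, ⟨p, hp, rfl⟩, rfl⟩
    refine mem_vecPoly.2 (divergence_mem ?_)
    have := (bubble_mem K (mem_vecPoly.1 hp)).2
    rwa [show n - 1 + 2 = n + 1 by omega] at this
  have h2 := LinearMap.BilinForm.finrank_orthogonal (vecForm_nondegenerate K n)
    (U.comap (vecPoly (Fin n) n n).subtype)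
  have h3 := Submodule.finrank_le (U.comap (vecPoly (Fin n) n n).subtype)
  have h4 : ((vecForm K n).orthogonal (U.comap (vecPoly (Fin n) n n).subtype)).map
      (vecPoly (Fin n) n n).subtype = vecPoly (Fin n) n n ⊓ LinearMap.ker (strain n) := by
    ext v
    constructor
    · rintro ⟨v, hv, rfl⟩
      refine ⟨v.2, (orthogonal_divergence_iff K hn v.2).1 fun τ hτ => ?_⟩
      exact hv ⟨divergence τ, hUV ⟨τ, hτ, rfl⟩⟩ ⟨τ, hτ, rfl⟩
    · rintro ⟨hv, hs⟩
      refine ⟨⟨v, hv⟩, ?_, rfl⟩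
      rintro ⟨_, hu⟩ ⟨τ, hτ, rfl⟩
      exact (orthogonal_divergence_iff K hn hv).2 hs τ hτ
  rw [← Submodule.finrank_map_subtype_eq, h4, finrank_ker_strain hn K,
    (Submodule.comapSubtypeEquivOfLe hUV).finrank_eq, finrank_vecPoly K, Fintype.card_fin] at h2
  rw [(Submodule.comapSubtypeEquivOfLe hUV).finrank_eq, finrank_vecPoly K, Fintype.card_fin] at h3
  omega

end DimensionM2

/-! ### Unisolvence -/

section Unisolvence

variable {n : ℕ} (K : Affine.Simplex ℝ (E n) n)

/-- The polynomial `uᵀ τ v`, as a bilinear function of `u` and `v`. -/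
def component (τ : MatField n) : E n →ₗ[ℝ] E n →ₗ[ℝ] MvPolynomial (Fin n) ℝ :=
  LinearMap.mk₂ ℝ (fun u v => ∑ k, ∑ l, (u k * v l) • τ k l)
    (fun u u' v => by simp [add_mul, add_smul, Finset.sum_add_distrib])
    (fun c u v => by simp [Finset.smul_sum, smul_smul, mul_assoc])
    (fun u v v' => by simp [mul_add, add_smul, Finset.sum_add_distrib])
    (fun c u v => by simp [Finset.smul_sum, smul_smul, mul_left_comm])

lemma component_apply (τ : MatField n) (u v : E n) :
    component τ u v = ∑ k, ∑ l, (u k * v l) • τ k l := rfl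

lemma component_comm {τ : MatField n} (hτ : τ.IsSymm) (u v : E n) :
    component τ u v = component τ v u := by
  rw [component_apply, component_apply, Finset.sum_comm]
  exact Finset.sum_congr rfl fun k _ => Finset.sum_congr rfl fun l _ => by
    rw [hτ.apply k l, mul_comm]

lemma eval_component (τ : MatField n) (u v : E n) (x : E n) :
    MvPolynomial.eval x.ofLp (component τ u v) = u.ofLp ⬝ᵥ (evalAt τ x).mulVec v.ofLp := by
  simp only [component_apply, map_sum, MvPolynomial.smul_eval, dotProduct, Matrix.mulVec, evalAt,
    Matrix.map_apply, Finset.mul_sum]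
  exact Finset.sum_congr rfl fun k _ => Finset.sum_congr rfl fun l _ => by ring

/-- The integral of a polynomial over a sub-simplex. -/
def faceIntegral {ℓ : ℕ} (s : Face n ℓ) : MvPolynomial (Fin n) ℝ →ₗ[ℝ] ℝ where
  toFun p := ∫ x in faceSet K s, MvPolynomial.eval x.ofLp p ∂μHE[ℓ]
  map_add' p q := by
    simp only [map_add]
    exact integral_add (integrable_simplex (K.face s.2) (continuous_eval p))
      (integrable_simplex (K.face s.2) (continuous_eval q))
  map_smul' c p := by
    simp only [MvPolynomial.smul_eval, RingHom.id_apply, smul_eq_mul]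
    exact integral_const_mul _ _

lemma faceIntegral_apply {ℓ : ℕ} (s : Face n ℓ) (p : MvPolynomial (Fin n) ℝ) :
    faceIntegral K s p = ∫ x in faceSet K s, MvPolynomial.eval x.ofLp p ∂μHE[ℓ] := rfl

lemma faceIntegral_congr {ℓ : ℕ} (s : Face n ℓ) {p q : MvPolynomial (Fin n) ℝ}
    (h : ∀ x ∈ faceSet K s, MvPolynomial.eval x.ofLp p = MvPolynomial.eval x.ofLp q) :
    faceIntegral K s p = faceIntegral K s q :=
  setIntegral_congr_fun (K.face s.2).isClosed_closedInterior.measurableSet h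

lemma faceMoment_eq {ℓ : ℕ} (s : Face n ℓ) (u v : E n) (q : MvPolynomial (Fin n) ℝ)
    (τ : MatField n) : faceMoment K s u v q τ =
      ((μHE[ℓ] : Measure (E n)).real (faceSet K s))⁻¹ * faceIntegral K s (component τ u v * q) := by
  rw [faceMoment, setAverage_eq, faceIntegral_apply, smul_eq_mul]
  simp only [map_mul, eval_component]

lemma faceMoment_eq_zero_iff {ℓ : ℕ} (s : Face n ℓ) (u v : E n) (q : MvPolynomial (Fin n) ℝ)
    (τ : MatField n) :
    faceMoment K s u v q τ = 0 ↔ faceIntegral K s (component τ u v * q) = 0 := by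
  have h := measure_simplex (K.face s.2)
  have h' : ((μHE[ℓ] : Measure (E n)).real (faceSet K s))⁻¹ ≠ 0 :=
    inv_ne_zero (ENNReal.toReal_ne_zero.2 h)
  rw [faceMoment_eq, mul_eq_zero, or_iff_right h']

lemma meanEntry_eq (i j : Fin n) (τ : MatField n) : meanEntry K i j τ =
      ((volume : Measure (E n)).real K.closedInterior)⁻¹ * polyIntegral K (τ i j) := by
  rw [meanEntry, setAverage_eq, polyIntegral_apply, smul_eq_mul]
  rfl

lemma meanEntry_eq_zero_iff (i j : Fin n) (τ : MatField n) :
    meanEntry K i j τ = 0 ↔ polyIntegral K (τ i j) = 0 := by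
  have h := measure_simplex K
  rw [EuclideanSpace.euclideanHausdorffMeasure_eq_volume] at h
  have h' : ((volume : Measure (E n)).real K.closedInterior)⁻¹ ≠ 0 :=
    inv_ne_zero (ENNReal.toReal_ne_zero.2 h)
  rw [meanEntry_eq, mul_eq_zero, or_iff_right h']

lemma innerK_eq (θ τ : MatField n) :
    innerK K θ τ = polyIntegral K (∑ i, ∑ j, τ i j * θ i j) := by
  rw [polyIntegral_apply]
  simp only [map_sum, map_mul]
  rfl

/-- If all the moments over the sub-simplices vanish, then `τ ν = 0` on each sub-simplex and for each
normal vector `ν` of it. On a sub-simplex of dimension `ℓ`, `uᵀ τ ν` vanishes on the boundary by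
induction, hence it is the product of `ℓ + 1` barycentric coordinates and of a polynomial of
degree `n - ℓ`, which is one of the weights. -/
lemma component_eq_zero_on_face {τ : MatField n} (hτ : τ ∈ symPoly n (n + 1))
    (H : ∀ ℓ < n, ∀ (s : Face n ℓ) (u : E n), ∀ v ∈ normalSpace K s,
      ∀ q ∈ MvPolynomial.restrictTotalDegree (Fin n) ℝ (n - ℓ),
        faceIntegral K s (component τ u v * q) = 0) :
    ∀ ℓ < n, ∀ (s : Face n ℓ) (u : E n), ∀ v ∈ normalSpace K s, ∀ x ∈ faceSet K s,
      MvPolynomial.eval x.ofLp (component τ u v) = 0 := by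
  intro ℓ
  induction ℓ using Nat.strong_induction_on with
  | _ ℓ IH =>
  intro hℓ s u v hv
  have hdeg : component τ u v ∈ MvPolynomial.restrictTotalDegree (Fin n) ℝ (n + 1) :=
    Submodule.sum_mem _ fun k _ => Submodule.sum_mem _ fun l _ => Submodule.smul_mem _ _ (hτ.2 k l)
  obtain ⟨G, hG, hGe⟩ := exists_bubble_on_face K s (by omega) hdeg fun r t hts x hx => by
    have hlt := Finset.card_lt_card hts
    rw [s.2, t.2] at hlt
    refine IH r (by omega) (by omega) t u v ?_ x hx
    rw [mem_normalSpace_iff] at hv ⊢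
    exact fun i hi j hj => hv i (hts.1 hi) j (hts.1 hj)
  have hval : ∀ x ∈ faceSet K s, MvPolynomial.eval x.ofLp (component τ u v * subst K G) =
      (∏ i ∈ s.1, (vertexBasis K).coord i x) * (MvPolynomial.eval x.ofLp (subst K G)) ^ 2 := by
    intro x hx
    rw [map_mul, hGe x hx, map_mul, map_mul, map_prod, map_prod]
    simp only [subst_X, eval_bary]
    ring
  have hint := H ℓ hℓ s u v hv (subst K G) (by
    rw [show n - ℓ = n + 1 - (ℓ + 1) by omega]
    exact subst_mem K (homog_isHomogeneous hG))
  have hzero := eq_zero_of_integral_simplex (K.face s.2)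
    (continuous_eval (component τ u v * subst K G)) (fun x hx => by
      rw [hval x hx]
      exact mul_nonneg (Finset.prod_nonneg fun i _ => ((mem_faceSet_iff K s x).1 hx).1 i)
        (sq_nonneg _)) hint
  have hG0 : G = 0 := by
    refine homog_eq_zero (Finset.card_pos.1 (by rw [s.2]; omega)) hG fun w hw hw0 hw1 => ?_
    have hx : ∑ j, w j • K.points j ∈ faceSet K s := by
      rw [mem_faceSet_iff]
      simp only [coord_sum_smul K hw1]
      refine ⟨fun i => ?_, hw0⟩
      by_cases hi : i ∈ s.1
      · exact (hw i hi).le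
      · exact (hw0 i hi).ge
    have h1 := hzero _ hx
    rw [hval _ hx, eval_subst] at h1
    simp only [coord_sum_smul K hw1] at h1
    exact pow_eq_zero_iff two_ne_zero |>.1
      ((mul_eq_zero.1 h1).resolve_left (Finset.prod_pos hw).ne')
  intro x hx
  rw [hGe x hx, hG0, mul_zero, map_zero, map_zero]

lemma span_eq_of_linearIndependent {V : Type*} [AddCommGroup V] [Module ℝ V] {m : ℕ}
    {f : Fin m → V} (hf : LinearIndependent ℝ f) {S : Submodule ℝ V} [Module.Finite ℝ S]
    (hS : ∀ i, f i ∈ S) (hm : Module.finrank ℝ S = m) :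
    Submodule.span ℝ (Set.range f) = S := by
  refine Submodule.eq_of_le_of_finrank_eq (Submodule.span_le.2 ?_) ?_
  · rintro _ ⟨i, rfl⟩
    exact hS i
  · rw [finrank_span_eq_card hf, hm, Fintype.card_fin]

lemma finrank_tangentSpace {ℓ : ℕ} (s : Face n ℓ) : Module.finrank ℝ (tangentSpace K s) = ℓ :=
  (K.face s.2).independent.finrank_vectorSpan (by simp)

lemma finrank_normalSpace {ℓ : ℕ} (s : Face n ℓ) :
    Module.finrank ℝ (normalSpace K s) = n - ℓ := by
  have h := (tangentSpace K s).finrank_add_finrank_orthogonal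
  rw [finrank_tangentSpace, finrank_euclideanSpace_fin] at h
  rw [normalSpace]
  omega

instance {ℓ : ℕ} (s : Face n ℓ) (k : ℕ) : Module.Finite ℝ (facePoly K s k) :=
  inferInstanceAs (Module.Finite ℝ ((MvPolynomial.restrictTotalDegree (Fin n) ℝ k).map
    (restrictTo (faceSet K s))))

/-- The moments for the given tangential vectors, normal vectors and weights determine the moments
for all of them. -/
lemma faceIntegral_component_eq_zero {τ : MatField n} (hτ : τ.IsSymm) {ℓ : ℕ} (hℓ : ℓ < n)
    (s : Face n ℓ) {t : Fin ℓ → E n} {ν : Fin (n - ℓ) → E n}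
    {q : Fin (n.choose ℓ) → MvPolynomial (Fin n) ℝ}
    (ht : LinearIndependent ℝ t ∧ ∀ l, t l ∈ tangentSpace K s)
    (hν : LinearIndependent ℝ ν ∧ ∀ i, ν i ∈ normalSpace K s)
    (hq : LinearIndependent ℝ (fun a => restrictTo (faceSet K s) (q a)) ∧
      ∀ a, q a ∈ MvPolynomial.restrictTotalDegree (Fin n) ℝ (n - ℓ))
    (h1 : ∀ l i a, faceIntegral K s (component τ (t l) (ν i) * q a) = 0)
    (h2 : ∀ i j, i ≤ j → ∀ a, faceIntegral K s (component τ (ν i) (ν j) * q a) = 0)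
    (u v : E n) (hv : v ∈ normalSpace K s) (p : MvPolynomial (Fin n) ℝ)
    (hp : p ∈ MvPolynomial.restrictTotalDegree (Fin n) ℝ (n - ℓ)) :
    faceIntegral K s (component τ u v * p) = 0 := by
  have hts := span_eq_of_linearIndependent ht.1 ht.2 (finrank_tangentSpace K s)
  have hνs := span_eq_of_linearIndependent hν.1 hν.2 (finrank_normalSpace K s)
  have hqs := span_eq_of_linearIndependent hq.1 (S := facePoly K s (n - ℓ))
    (fun a => ⟨_, hq.2 a, rfl⟩) (by
      rw [finrank_facePoly, Nat.add_sub_cancel' hℓ.le, Nat.choose_symm hℓ.le])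
  -- the weight
  have hweight : ∀ w z : E n, (∀ a, faceIntegral K s (component τ w z * q a) = 0) →
      faceIntegral K s (component τ w z * p) = 0 := by
    intro w z h
    have hmem : restrictTo (faceSet K s) p ∈ facePoly K s (n - ℓ) := ⟨p, hp, rfl⟩
    rw [← hqs, Submodule.mem_span_range_iff_exists_fun] at hmem
    obtain ⟨c, hc⟩ := hmem
    rw [faceIntegral_congr K s (q := ∑ a, c a • (component τ w z * q a)), map_sum]
    · exact Finset.sum_eq_zero fun a _ => by rw [map_smul, h, smul_zero]
    · intro x hx
      have := congrFun hc ⟨x, hx⟩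
      simp only [Finset.sum_apply, Pi.smul_apply, restrictTo, LinearMap.pi_apply,
        AlgHom.toLinearMap_apply, MvPolynomial.aeval_eq_eval, smul_eq_mul] at this
      simp only [map_mul, map_sum, MvPolynomial.smul_eval]
      rw [← this, Finset.mul_sum]
      exact Finset.sum_congr rfl fun a _ => by ring
  -- the normal vector
  have hnormal : ∀ w : E n, (∀ i, faceIntegral K s (component τ w (ν i) * p) = 0) →
      faceIntegral K s (component τ w v * p) = 0 := by
    intro w h
    obtain ⟨L, hL⟩ : ∃ L : E n →ₗ[ℝ] ℝ, ∀ z, L z = faceIntegral K s (component τ w z * p) :=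
      ⟨faceIntegral K s ∘ₗ (LinearMap.mulRight ℝ p) ∘ₗ component τ w, fun _ => rfl⟩
    have hle : normalSpace K s ≤ LinearMap.ker L := by
      rw [← hνs, Submodule.span_le]
      rintro _ ⟨i, rfl⟩
      exact (hL _).trans (h i)
    rw [← hL]
    exact LinearMap.mem_ker.1 (hle hv)
  -- the other vector
  obtain ⟨L, hL⟩ : ∃ L : E n →ₗ[ℝ] ℝ, ∀ w, L w = faceIntegral K s (component τ w v * p) :=
    ⟨faceIntegral K s ∘ₗ (LinearMap.mulRight ℝ p) ∘ₗ (component τ).flip v, fun _ => rfl⟩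
  have htop : (⊤ : Submodule ℝ (E n)) ≤ LinearMap.ker L := by
    rw [← (tangentSpace K s).sup_orthogonal_of_hasOrthogonalProjection]
    refine sup_le ?_ ?_
    · rw [← hts, Submodule.span_le]
      rintro _ ⟨l, rfl⟩
      exact (hL _).trans (hnormal _ fun i => hweight _ _ (h1 l i))
    · change normalSpace K s ≤ _
      rw [← hνs, Submodule.span_le]
      rintro _ ⟨j, rfl⟩
      refine (hL _).trans (hnormal _ fun i => hweight _ _ fun a => ?_)
      rcases le_total j i with hij | hij
      · exact h2 j i hij a
      · rw [component_comm hτ]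
        exact h2 i j hij a
  rw [← hL]
  exact LinearMap.mem_ker.1 (htop (Submodule.mem_top (x := u)))

/-- A field with `τ ν = 0` on the boundary, vanishing mean and divergence of degree at most one is
divergence-free: its divergence is orthogonal to the affine vector fields. -/
lemma divergence_eq_zero (hn : 1 ≤ n) {τ : MatField n} (hτ : τ ∈ P2Star n) (h : NormalFree K τ)
    (hmean : ∀ i j, polyIntegral K (τ i j) = 0) : divergence τ = 0 := by
  have hτ' := (mem_P2Star_iff hn).1 hτ
  obtain ⟨p, -, rfl⟩ := exists_eq_bubble K hn hτ'.1 h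
  refine eq_zero_of_polyIntegral_sum_sq K ?_
  rw [polyIntegral_divergence_bubble, ← sum_bubble_mul_pderiv, neg_eq_zero, map_sum]
  refine Finset.sum_eq_zero fun k _ => ?_
  rw [map_sum]
  refine Finset.sum_eq_zero fun l _ => ?_
  have h0 := (MvPolynomial.mem_restrictTotalDegree _ _ _).1 (pderiv_mem l (k := 0) (hτ'.2 k))
  rw [MvPolynomial.totalDegree_eq_zero_iff_eq_C.1 (Nat.le_zero.1 h0), mul_comm,
    ← MvPolynomial.smul_eq_C_mul, map_smul, hmean, smul_zero]

variable {m : ℕ} (t : (ℓ : Fin n) → Face n ℓ → Fin ℓ → E n)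
  (ν : (ℓ : Fin n) → Face n ℓ → Fin (n - ℓ) → E n)
  (q : (ℓ : Fin n) → Face n ℓ → Fin (n.choose ℓ) → MvPolynomial (Fin n) ℝ)

/-- The degrees of freedom as a linear map. -/
def dofsL (θ : Fin m → MatField n) : MatField n →ₗ[ℝ] (DofIndex n m → ℝ) where
  toFun := dofs K t ν q θ
  map_add' σ τ := by
    have hc : ∀ u v, component (σ + τ) u v = component σ u v + component τ u v := fun u v => by
      simp [component_apply, Finset.sum_add_distrib]
    funext d
    rcases d with ⟨ℓ, s, (⟨l, i⟩ | p), a⟩ | p | b <;>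
      simp [dofs, faceMoment_eq, meanEntry_eq, innerK_eq, hc, add_mul, mul_add,
        Finset.sum_add_distrib]
  map_smul' c τ := by
    have hc : ∀ u v, component (c • τ) u v = c • component τ u v := fun u v => by
      simp [component_apply, Finset.smul_sum, smul_comm c]
    funext d
    rcases d with ⟨ℓ, s, (⟨l, i⟩ | p), a⟩ | p | b <;>
      simp [dofs, faceMoment_eq, meanEntry_eq, innerK_eq, hc, mul_left_comm c, ← Finset.smul_sum]

/-- A field of the enriched space whose degrees of freedom vanish is zero. -/
lemma eq_zero_of_dofs_eq_zero (hn : 1 ≤ n)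
    (θ : Module.Basis (Fin (Module.finrank ℝ (M2 K))) ℝ (M2 K))
    (ht : ∀ ℓ s, LinearIndependent ℝ (t ℓ s) ∧ ∀ l, t ℓ s l ∈ tangentSpace K s)
    (hν : ∀ ℓ s, LinearIndependent ℝ (ν ℓ s) ∧ ∀ i, ν ℓ s i ∈ normalSpace K s)
    (hq : ∀ ℓ s, LinearIndependent ℝ (fun a => restrictTo (faceSet K s) (q ℓ s a)) ∧
      ∀ a, q ℓ s a ∈ MvPolynomial.restrictTotalDegree (Fin n) ℝ (n - ℓ))
    {τ : MatField n} (hτ : τ ∈ P2Star n)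
    (h : dofs K t ν q (fun b => (θ b : MatField n)) τ = 0) : τ = 0 := by
  have hτ' := P2Star_le hn hτ
  have hface : NormalFree K τ := by
    have h1 := component_eq_zero_on_face K hτ' fun ℓ hℓ s u v hv p hp =>
      faceIntegral_component_eq_zero K hτ'.1 hℓ s (ht ⟨ℓ, hℓ⟩ s) (hν ⟨ℓ, hℓ⟩ s) (hq ⟨ℓ, hℓ⟩ s)
        (fun l i a => (faceMoment_eq_zero_iff K s _ _ _ τ).1
          (congrFun h (.inl ⟨⟨ℓ, hℓ⟩, s, .inl (l, i), a⟩)))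
        (fun i j hij a => (faceMoment_eq_zero_iff K s _ _ _ τ).1
          (congrFun h (.inl ⟨⟨ℓ, hℓ⟩, s, .inr ⟨(i, j), hij⟩, a⟩))) u v hv p hp
    intro s x hx v hv
    funext k
    have h2 := h1 (n - 1) (by omega) s (EuclideanSpace.single k 1) v hv x hx
    rw [eval_component] at h2
    simpa using h2
  have hmean : ∀ i j, polyIntegral K (τ i j) = 0 := by
    have h1 : ∀ i j, i ≤ j → polyIntegral K (τ i j) = 0 := fun i j hij =>
      (meanEntry_eq_zero_iff K i j τ).1 (congrFun h (.inr (.inl ⟨(i, j), hij⟩)))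
    intro i j
    rcases le_total i j with hij | hij
    · exact h1 i j hij
    · rw [← hτ'.1.apply]
      exact h1 j i hij
  have hM : τ ∈ M2 K := ⟨hτ, divergence_eq_zero K hn hτ hface hmean, hface⟩
  have hle : M2 K ≤ LinearMap.ker (polyIntegral K ∘ₗ
      (∑ i, ∑ j, LinearMap.mulLeft ℝ (τ i j) ∘ₗ Matrix.entryLinearMap ℝ _ i j)) := by
    have hspan : (M2 K) = (Submodule.span ℝ (Set.range θ)).map (M2 K).subtype := by
      rw [θ.span_eq, Submodule.map_subtype_top]
    rw [hspan, Submodule.map_span, Submodule.span_le]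
    rintro _ ⟨_, ⟨b, rfl⟩, rfl⟩
    have h1 : innerK K (θ b) τ = 0 := congrFun h (.inr (.inr b))
    rw [innerK_eq] at h1
    simpa using h1
  have h2 := hle hM
  have h3 : (fun ij : Fin n × Fin n => τ ij.1 ij.2) = 0 := by
    refine eq_zero_of_polyIntegral_sum_sq K ?_
    rw [Fintype.sum_prod_type]
    simpa using h2
  ext1 i j
  exact congrFun h3 (i, j)

end Unisolvence

/-! ### Counting the degrees of freedom -/

section Counting

lemma card_faceIndex {n ℓ : ℕ} (hℓ : ℓ ≤ n) : Fintype.card (FaceIndex n ℓ) =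
    ((n + 1 - ℓ).choose 2 + ℓ * (n - ℓ)) * n.choose ℓ := by
  rw [Fintype.card_prod, Fintype.card_sum, Fintype.card_prod, card_symPair,
    Fintype.card_fin, Fintype.card_fin, Fintype.card_fin, Nat.sub_add_comm hℓ, add_comm]

lemma card_faceIndex_cast {n ℓ : ℕ} (hℓ : ℓ ≤ n) : (Fintype.card (FaceIndex n ℓ) : ℚ) =
    ((n : ℚ) - ℓ) * (n + ℓ + 1) / 2 * n.choose ℓ := by
  obtain ⟨d, rfl⟩ := Nat.exists_eq_add_of_le hℓ
  rw [card_faceIndex hℓ, show ℓ + d + 1 - ℓ = d + 1 by omega, Nat.add_sub_cancel_left]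
  push_cast
  rw [Nat.cast_choose_two]
  push_cast
  ring

lemma card_boundaryIndex (n : ℕ) : (Fintype.card (BoundaryIndex n) : ℚ) =
    ∑ ℓ ∈ Finset.range n,
      ((n + 1).choose (ℓ + 1) : ℚ) * (((n : ℚ) - ℓ) * (n + ℓ + 1) / 2) * n.choose ℓ := by
  rw [Finset.sum_range, Fintype.card_sigma]
  push_cast
  refine Finset.sum_congr rfl fun ℓ _ => ?_
  rw [Fintype.card_prod, Nat.cast_mul, card_faceIndex_cast ℓ.2.le, Fintype.card_finset_len,
    Fintype.card_fin, ← mul_assoc]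

/-- A case of the Vandermonde identity. -/
lemma sum_choose_mul_choose (n : ℕ) :
    ∑ ℓ ∈ Finset.range (n + 1), (n + 1).choose (ℓ + 1) * n.choose ℓ = (2 * n + 1).choose n := by
  rw [show 2 * n + 1 = n + (n + 1) by ring, Nat.add_choose_eq,
    Finset.Nat.sum_antidiagonal_eq_sum_range_succ fun i j => n.choose i * (n + 1).choose j]
  refine Finset.sum_congr rfl fun ℓ hℓ => ?_
  rw [mul_comm, ← Nat.choose_symm_of_eq_add (show n + 1 = (n - ℓ) + (ℓ + 1) by
    have := Finset.mem_range.1 hℓ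
    omega)]

lemma sum_mul_choose_mul_choose (n : ℕ) :
    ∑ ℓ ∈ Finset.range (n + 2), ((ℓ : ℚ) * (ℓ + 1)) *
      ((n + 2).choose (ℓ + 1) * (n + 1).choose ℓ : ℚ) =
      (n + 1) * (n + 2) * (2 * n + 1).choose n := by
  rw [Finset.sum_range_succ', ← sum_choose_mul_choose n]
  push_cast
  rw [zero_mul, zero_mul, add_zero, Finset.mul_sum]
  refine Finset.sum_congr rfl fun ℓ _ => ?_
  have h1 : ((n + 2 : ℕ) : ℚ) * (n + 1).choose (ℓ + 1) = (n + 2).choose (ℓ + 2) * (ℓ + 2 : ℕ) := by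
    exact_mod_cast Nat.add_one_mul_choose_eq (n + 1) (ℓ + 1)
  have h2 : ((n + 1 : ℕ) : ℚ) * n.choose ℓ = (n + 1).choose (ℓ + 1) * (ℓ + 1 : ℕ) := by
    exact_mod_cast Nat.add_one_mul_choose_eq n ℓ
  push_cast at h1 h2
  calc _ = ((n + 2).choose (ℓ + 2) * ((ℓ : ℚ) + 2)) * ((n + 1).choose (ℓ + 1) * ((ℓ : ℚ) + 1)) := by
        ring
    _ = _ := by
        rw [← h1, ← h2]
        ring

lemma sum_boundary {n : ℕ} (hn : 1 ≤ n) :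
    ∑ ℓ ∈ Finset.range n,
      ((n + 1).choose (ℓ + 1) : ℚ) * (((n : ℚ) - ℓ) * (n + ℓ + 1) / 2) * n.choose ℓ =
    (2 * n + 1).choose n * ((n : ℚ) * (n + 1) / 2) -
      (2 * n - 1).choose n * ((n : ℚ) * (n + 1) / 2) := by
  obtain ⟨m, rfl⟩ := Nat.exists_eq_add_of_le' hn
  have h1 := sum_choose_mul_choose (m + 1)
  have h2 := sum_mul_choose_mul_choose m
  have h3 : (2 * (m + 1) - 1).choose (m + 1) = (2 * m + 1).choose m := by
    rw [show 2 * (m + 1) - 1 = 2 * m + 1 by omega]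
    exact Nat.choose_symm_of_eq_add (by ring)
  have h1' : ∑ ℓ ∈ Finset.range (m + 2), ((m + 2).choose (ℓ + 1) * (m + 1).choose ℓ : ℚ) =
      (2 * (m + 1) + 1).choose (m + 1) := by
    exact_mod_cast h1
  have h4 : ∀ ℓ : ℕ, ((m + 1 + 1).choose (ℓ + 1) : ℚ) *
      ((((m + 1 : ℕ) : ℚ) - ℓ) * ((m + 1 : ℕ) + ℓ + 1) / 2) * (m + 1).choose ℓ =
      (((m : ℚ) + 1) * (m + 2) / 2) * ((m + 2).choose (ℓ + 1) * (m + 1).choose ℓ) -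
      1 / 2 * (((ℓ : ℚ) * (ℓ + 1)) * ((m + 2).choose (ℓ + 1) * (m + 1).choose ℓ)) := by
    intro ℓ
    push_cast
    ring
  rw [h3]
  -- the summand vanishes for `ℓ = n`
  have h5 := Finset.sum_range_succ (fun ℓ : ℕ => ((m + 1 + 1).choose (ℓ + 1) : ℚ) *
      ((((m + 1 : ℕ) : ℚ) - ℓ) * ((m + 1 : ℕ) + ℓ + 1) / 2) * (m + 1).choose ℓ) (m + 1)
  rw [sub_self, zero_mul, zero_div, mul_zero, zero_mul, add_zero] at h5
  rw [← h5, Finset.sum_congr rfl fun ℓ _ => h4 ℓ, Finset.sum_sub_distrib, ← Finset.mul_sum,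
    ← Finset.mul_sum, h1', h2]
  push_cast
  ring

open scoped Nat in
lemma cast_choose_eq (a b : ℕ) : ((a + b).choose a : ℚ) = ((a + b)! : ℚ) / (a ! * b !) :=
  Nat.cast_add_choose ℚ

end Counting

end SymFE
end

theorem theorem3p1 (n : ℕ) (hn : 1 ≤ n) (K : Affine.Simplex ℝ (E n) n) :
    -- unisolvence: every prescription of the degrees of freedom is attained exactly once
    (∀ (t : (ℓ : Fin n) → Face n ℓ → Fin ℓ → E n)
       (ν : (ℓ : Fin n) → Face n ℓ → Fin (n - ℓ) → E n)
       (q : (ℓ : Fin n) → Face n ℓ → Fin (n.choose ℓ) → MvPolynomial (Fin n) ℝ)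
       (θ : Module.Basis (Fin (Module.finrank ℝ (M2 K))) ℝ (M2 K)),
       (∀ ℓ s, LinearIndependent ℝ (t ℓ s) ∧ ∀ l, t ℓ s l ∈ tangentSpace K s) →
       (∀ ℓ s, LinearIndependent ℝ (ν ℓ s) ∧ ∀ i, ν ℓ s i ∈ normalSpace K s) →
       (∀ ℓ s, LinearIndependent ℝ (fun a => restrictTo (faceSet K s) (q ℓ s a)) ∧
         ∀ a, q ℓ s a ∈ MvPolynomial.restrictTotalDegree (Fin n) ℝ (n - ℓ)) →
       Function.Bijective (fun τ : P2Star n => dofs K t ν q (fun b => (θ b : MatField n)) τ)) ∧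
    -- the weights on a sub-simplex, and the number of degrees of freedom on it
    (∀ (ℓ : Fin n) (s : Face n ℓ), Module.finrank ℝ (facePoly K s (n - ℓ)) = n.choose ℓ) ∧
    (∀ ℓ : Fin n,
      Fintype.card (FaceIndex n ℓ) = ((n + 1 - ℓ).choose 2 + ℓ * (n - ℓ)) * n.choose ℓ ∧
      (Fintype.card (FaceIndex n ℓ) : ℚ) = ((n : ℚ) - ℓ) * (n + ℓ + 1) / 2 * n.choose ℓ) ∧
    -- the numbers of degrees of freedom in the three sets
    (Fintype.card (BoundaryIndex n) : ℚ) =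
      ∑ ℓ ∈ Finset.range n,
        ((n + 1).choose (ℓ + 1) : ℚ) * (((n : ℚ) - ℓ) * (n + ℓ + 1) / 2) * n.choose ℓ ∧
    (Fintype.card (BoundaryIndex n) : ℚ) =
      ((2 * n + 1)! : ℚ) / (n ! * (n + 1)!) * ((n : ℚ) * (n + 1) / 2) -
        ((2 * n - 1)! : ℚ) / (n ! * (n - 1)!) * ((n : ℚ) * (n + 1) / 2) ∧
    (Fintype.card (SymPair n) : ℚ) = (n : ℚ) * (n + 1) / 2 ∧
    (Module.finrank ℝ (M2 K) : ℚ) =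
      ((2 * n - 1)! : ℚ) / (n ! * (n - 1)!) * ((n : ℚ) * (n + 1) / 2) + (n : ℚ) * (n + 1) / 2 -
        n * (((2 * n)! : ℚ) / (n ! * n !)) ∧
    -- the total number of degrees of freedom is the dimension of the enriched space
    Fintype.card (DofIndex n (Module.finrank ℝ (M2 K))) = Module.finrank ℝ (P2Star n) ∧
    (Module.finrank ℝ (P2Star n) : ℚ) =
      ((2 * n + 1)! : ℚ) / (n ! * (n + 1)!) * ((n : ℚ) * (n + 1) / 2) -
        n * (((2 * n)! : ℚ) / (n ! * n !)) + n * (n + 1) := by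
  have hfin := finite_P2Star hn
  -- the number of components of a symmetric matrix
  set N : ℚ := (n : ℚ) * (n + 1) / 2 with hN
  have hA : ((2 * n + 1)! : ℚ) / (n ! * (n + 1)!) = (2 * n + 1).choose n := by
    have := cast_choose_eq n (n + 1)
    rw [show n + (n + 1) = 2 * n + 1 by ring] at this
    exact this.symm
  have hD : ((2 * n - 1)! : ℚ) / (n ! * (n - 1)!) = (2 * n - 1).choose n := by
    have := cast_choose_eq n (n - 1)
    rw [show n + (n - 1) = 2 * n - 1 by omega] at this
    exact this.symm
  have hF : ((2 * n)! : ℚ) / (n ! * n !) = (2 * n).choose n := by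
    have := cast_choose_eq n n
    rw [← two_mul] at this
    exact this.symm
  have hN2 : ((n + 1).choose 2 : ℚ) = N := by
    rw [Nat.cast_choose_two, hN]
    push_cast
    ring
  have hsym : (Fintype.card (SymPair n) : ℚ) = N := by rw [card_symPair, hN2]
  have hM : (Module.finrank ℝ (M2 K) : ℚ) =
      (2 * n - 1).choose n * N + N - n * (2 * n).choose n := by
    have h := finrank_M2 K hn
    rw [show n + (n - 1) = 2 * n - 1 by omega, ← two_mul,
      ← Nat.choose_symm_of_eq_add (show 2 * n - 1 = n + (n - 1) by omega)] at h
    have h' := congrArg (Nat.cast (R := ℚ)) h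
    push_cast at h'
    rw [hN2] at h'
    linarith
  have hP : (Module.finrank ℝ (P2Star n) : ℚ) =
      (2 * n + 1).choose n * N - n * (2 * n).choose n + n * (n + 1) := by
    have h := finrank_P2Star hn K
    rw [show n + (n + 1) = 2 * n + 1 by ring, ← two_mul,
      ← Nat.choose_symm_of_eq_add (show 2 * n + 1 = n + (n + 1) by ring)] at h
    have h' := congrArg (Nat.cast (R := ℚ)) h
    push_cast at h'
    rw [hN2] at h'
    linarith
  have hB : (Fintype.card (BoundaryIndex n) : ℚ) =
      (2 * n + 1).choose n * N - (2 * n - 1).choose n * N := by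
    rw [card_boundaryIndex, sum_boundary hn]
  have htotal : Fintype.card (DofIndex n (Module.finrank ℝ (M2 K))) =
      Module.finrank ℝ (P2Star n) := by
    have h : (Fintype.card (DofIndex n (Module.finrank ℝ (M2 K))) : ℚ) =
        Module.finrank ℝ (P2Star n) := by
      rw [Fintype.card_sum, Fintype.card_sum, Fintype.card_fin]
      push_cast
      rw [hB, hsym, hM, hP, hN]
      ring
    exact_mod_cast h
  refine ⟨?_, fun ℓ s => ?_, fun ℓ => ⟨card_faceIndex ℓ.2.le, card_faceIndex_cast ℓ.2.le⟩,
    card_boundaryIndex n, ?_, hsym, ?_, htotal, ?_⟩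
  · intro t ν q θ ht hν hq
    set L := (dofsL K t ν q fun b => (θ b : MatField n)).domRestrict (P2Star n) with hL
    have hinj : Function.Injective L := by
      rw [← LinearMap.ker_eq_bot, LinearMap.ker_eq_bot']
      exact fun τ hτ => Subtype.ext (eq_zero_of_dofs_eq_zero K t ν q hn θ ht hν hq τ.2 hτ)
    refine ⟨hinj, (LinearMap.injective_iff_surjective_of_finrank_eq_finrank ?_).1 hinj⟩
    rw [Module.finrank_fintype_fun_eq_card, htotal]
  · rw [finrank_facePoly, Nat.add_sub_cancel' ℓ.2.le, Nat.choose_symm ℓ.2.le]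
  · rw [hA, hD, hB]
  · rw [hD, hF, hM]
  · rw [hA, hF, hP]
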